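/- **Setting.** Spacetime is covered by one coordinate system $x=(x^0,\mathbf x)=(ct,\mathbf x)$ ranging over an open subset of $\mathbb R^4$. It carries a $C^2$ Lorentzian metric $g_{\mu\nu}$ of signature $(+,-,-,-)$ with $g_{00}>0$, and it contains a moving linear isotropic nondispersive fluid dielectric with permittivity $\epsilon(x)>0$, permeability $\mu(x)>0$ (of class $C^2$, equal to the vacuum values $\epsilon_0,\mu_0$ outside of the medium) and future-pointing unit 4-velocity $w^\mu$. Put $c=(\epsilon_0\mu_0)^{-1/2}$, $n=c\sqrt{\epsilon\mu}$, and let $$\bar g_{\mu\nu}=g_{\mu\nu}-\Big(1-\frac1{n^2}\Big)w_\mu w_\nu,\qquad \bar g^{\mu\nu}=g^{\mu\nu}+(n^2-1)w^\mu w^\nu$$ be Gordon's optical metric and its inverse, where $(n^2-1)w^\mu w^\nu$ is assumed to be of class $C^2$. **Light rays in the geometrical optics approximation.** A geometrical optics wave on an open set is given by a real phase $\mathscr S$ and a nowhere vanishing complex covector amplitude $a_\mu$, both $C^2$, such that the potential $A_\mu=a_\mu e^{i\omega\mathscr S}$, with $F_{\mu\nu}=\partial_\mu A_\nu-\partial_\nu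 A_\mu$, satisfies to leading order as $\omega\to\infty$ the source-free Maxwell equations $\bar\nabla_\mu\big(\sqrt{\epsilon/\mu}\;\bar g^{\mu\alpha}\bar g^{\nu\beta}F_{\alpha\beta}\big)=0$ and the gauge condition $\bar\nabla_\mu(\bar g^{\mu\nu}A_\nu)=0$ (that is, up to $o(\omega^2)$ and $o(\omega)$ respectively). Its wave covector is $k_\mu=\partial_\mu\mathscr S$. A light ray is a curve parametrized by $[0,1]$ which near each of its points is an integral curve of $\bar k^\mu=\bar g^{\mu\nu}k_\nu$ for some such wave, with $w^\mu k_\mu>0$ (future-directed). **Range transfer functions.** Suppose that for all $(\mathbf x_A,t_B,\mathbf x_B)$ in a set $D_r$ there is one and only one $t_A$ such that a light ray goes from $x_A=(ct_A,\mathbf x_A)$ to $x_B=(ct_B,\mathbf x_B)$. Write $t_B-t_A=\mathcal T_r(\mathbf x_A,t_B,\mathbf x_B)$ and $\mathcal R_r(\mathbf x_A,x_B)=c\,\mathcal T_r(\mathbf x_A,t_B,\mathbf x_B)$. Likewise, suppose that for all $(t_A,\mathbf x_A,\mathbf x_B)$ in a set $D_e$ there is one and only one $t_B$ such that a light ray goes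 from $x_A$ to $x_B$, and write $t_B-t_A=\mathcal T_e(t_A,\mathbf x_A,\mathbf x_B)$ and $\mathcal R_e(x_A,\mathbf x_B)=c\,\mathcal T_e(t_A,\mathbf x_A,\mathbf x_B)$. **Theorem.** The range transfer functions satisfy the following Hamilton–Jacobi-like equations over the optical spacetime (Latin indices run over $1,2,3$; repeated indices are summed). If $D_r$ contains $(\mathbf x,t_B,\mathbf x_B)$ for all $\mathbf x$ near $\mathbf x_A$ and $\mathcal R_r(\cdot,x_B)$ is $C^1$ near $\mathbf x_A$, then $$\bar g^{00}(x_B^0-\mathcal R_r,\mathbf x_A)+2\,\bar g^{0i}(x_B^0-\mathcal R_r,\mathbf x_A)\frac{\partial\mathcal R_r}{\partial x_A^i}+\bar g^{ij}(x_B^0-\mathcal R_r,\mathbf x_A)\frac{\partial\mathcal R_r}{\partial x_A^i}\frac{\partial\mathcal R_r}{\partial x_A^j}=0,$$ where $\mathcal R_r$ and its derivatives are taken at $(\mathbf x_A,x_B)$. If $D_e$ contains $(t_A,\mathbf x_A,\mathbf x)$ for all $\mathbf x$ near $\mathbf x_B$ and $\mathcal R_e(x_A,\cdot)$ is $C^1$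 near $\mathbf x_B$, then $$\bar g^{00}(x_A^0+\mathcal R_e,\mathbf x_B)-2\,\bar g^{0i}(x_A^0+\mathcal R_e,\mathbf x_B)\frac{\partial\mathcal R_e}{\partial x_B^i}+\bar g^{ij}(x_A^0+\mathcal R_e,\mathbf x_B)\frac{\partial\mathcal R_e}{\partial x_B^i}\frac{\partial\mathcal R_e}{\partial x_B^j}=0,$$ where $\mathcal R_e$ and its derivatives are taken at $(x_A,\mathbf x_B)$. -/

import Mathlib

open Filter Topology Set

noncomputable section

/-- Events, identified with their four coordinates `(x⁰, x¹, x², x³)`. -/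
abbrev Event := Fin 4 → ℝ

/-- Spatial positions, identified with their three coordinates. -/
abbrev Position := Fin 3 → ℝ

/-- The event with coordinates `(x⁰, 𝐱)`. -/
def mkEvent (x0 : ℝ) (x : Position) : Event := Fin.cons x0 x

/-- The spatial part `𝐱` of an event `(x⁰, 𝐱)`. -/
def Event.position (x : Event) : Position := Fin.tail x

/-- The partial derivative of `f` with respect to the `i`-th coordinate, at `x`. -/
def partialDeriv {m : ℕ} {F : Type*} [NormedAddCommGroup F] [NormedSpace ℝ F]
    (i : Fin m) (f : (Fin m → ℝ) → F) (x : Fin m → ℝ) : F :=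
  fderiv ℝ f x (Pi.single i 1)

/-- A spacetime covered by one coordinate system and containing a moving, linear, isotropic,
nondispersive fluid dielectric. Signature `(+,-,-,-)`. -/
structure OpticalSpacetime where
  /-- vacuum permittivity -/
  eps0 : ℝ
  /-- vacuum permeability -/
  mu0 : ℝ
  eps0_pos : 0 < eps0
  mu0_pos : 0 < mu0
  /-- the coordinate domain: the set of quadruples that are coordinates of an event -/
  region : Set Event
  isOpen_region : IsOpen region
  /-- covariant components of the physical metric -/
  g : Event → Matrix (Fin 4) (Fin 4) ℝ
  g_contDiff : ∀ μ ν, ContDiffOn ℝ 2 (fun x => g x μ ν) region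
  g_symm : ∀ x ∈ region, (g x).IsSymm
  g_signature : ∀ x ∈ region, ∃ P : Matrix (Fin 4) (Fin 4) ℝ, IsUnit P.det ∧
    P.transpose * g x * P = Matrix.diagonal ![1, -1, -1, -1]
  /-- `∂/∂x⁰` is timelike -/
  g_zero_zero_pos : ∀ x ∈ region, 0 < g x 0 0
  /-- the part of spacetime that is filled with the medium -/
  medium : Set Event
  /-- permittivity -/
  eps : Event → ℝ
  /-- permeability -/
  mu : Event → ℝ
  eps_pos : ∀ x ∈ region, 0 < eps x
  mu_pos : ∀ x ∈ region, 0 < mu x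
  eps_contDiff : ContDiffOn ℝ 2 eps region
  mu_contDiff : ContDiffOn ℝ 2 mu region
  eps_vacuum : ∀ x ∈ region, x ∉ medium → eps x = eps0
  mu_vacuum : ∀ x ∈ region, x ∉ medium → mu x = mu0
  /-- contravariant components of the 4-velocity of the medium. Outside of the medium it is any
  unit future-pointing timelike vector, not required to vary continuously with the event: since
  the refractive index is `1` there, the optical metric does not depend on it. -/
  w : Event → Event
  w_unit : ∀ x ∈ region, ∑ μ, ∑ ν, g x μ ν * w x μ * w x ν = 1
  w_future : ∀ x ∈ region, 0 < ∑ μ, g x 0 μ * w x μ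
  /-- the refractive part `κ^{μν} = (n² - 1) w^μ w^ν` of the optical metric, where
  `n² = ε μ / (ε₀ μ₀)`, is of class `C²` -/
  kappa_contDiff : ∀ μ ν,
    ContDiffOn ℝ 2 (fun x => (eps x * mu x / (eps0 * mu0) - 1) * (w x μ * w x ν)) region

namespace OpticalSpacetime

variable (M : OpticalSpacetime)

/-- The speed of light in a vacuum, `c = (ε₀ μ₀)^{-1/2}`. -/
def c : ℝ := (√(M.eps0 * M.mu0))⁻¹

/-- The index of refraction `n = c √(ε μ)`. -/
def n (x : Event) : ℝ := M.c * √(M.eps x * M.mu x)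

/-- Covariant components `w_μ` of the 4-velocity of the medium. -/
def wLow (x : Event) (μ : Fin 4) : ℝ := ∑ ν, M.g x μ ν * M.w x ν

/-- Gordon's optical metric, covariant components:
`ḡ_{μν} = g_{μν} - (1 - 1/n²) w_μ w_ν`. -/
def gBarLow (x : Event) : Matrix (Fin 4) (Fin 4) ℝ :=
  fun μ ν => M.g x μ ν - (1 - 1 / M.n x ^ 2) * M.wLow x μ * M.wLow x ν

/-- Gordon's optical metric, contravariant components:
`ḡ^{μν} = g^{μν} + (n² - 1) w^μ w^ν`. -/
def gBar (x : Event) : Matrix (Fin 4) (Fin 4) ℝ :=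
  fun μ ν => (M.g x)⁻¹ μ ν + (M.n x ^ 2 - 1) * M.w x μ * M.w x ν

/-- Christoffel symbols `Γ̄^σ_{μν}` of the optical metric. -/
def christoffel (σ μ ν : Fin 4) (x : Event) : ℝ :=
  (1 / 2) * ∑ ρ, M.gBar x σ ρ *
    (partialDeriv μ (fun y => M.gBarLow y ρ ν) x + partialDeriv ν (fun y => M.gBarLow y ρ μ) x
      - partialDeriv ρ (fun y => M.gBarLow y μ ν) x)

/-- The divergence `∇̄_μ V^μ` of a complex vector field, for the optical metric. -/
def div (V : Event → Fin 4 → ℂ) (x : Event) : ℂ :=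
  ∑ μ, (partialDeriv μ (fun y => V y μ) x + ∑ ρ, (M.christoffel μ μ ρ x : ℂ) * V x ρ)

/-- The divergence `∇̄_μ B^{μν}` of a complex tensor field, for the optical metric. -/
def divTensor (B : Event → Fin 4 → Fin 4 → ℂ) (ν : Fin 4) (x : Event) : ℂ :=
  ∑ μ, (partialDeriv μ (fun y => B y μ ν) x
    + ∑ ρ, (M.christoffel μ μ ρ x : ℂ) * B x ρ ν
    + ∑ ρ, (M.christoffel ν μ ρ x : ℂ) * B x μ ρ)

/-- The electromagnetic field `F_{μν} = ∂_μ A_ν - ∂_ν A_μ` of a complex potential. -/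
def faraday (A : Event → Fin 4 → ℂ) (x : Event) (μ ν : Fin 4) : ℂ :=
  partialDeriv μ (fun y => A y ν) x - partialDeriv ν (fun y => A y μ) x

/-- The field `F̄^{μν} = ḡ^{μα} ḡ^{νβ} F_{αβ}`, with indices raised by the optical metric. -/
def faradayUp (A : Event → Fin 4 → ℂ) (x : Event) (μ ν : Fin 4) : ℂ :=
  ∑ α, ∑ β, (M.gBar x μ α : ℂ) * (M.gBar x ν β : ℂ) * faraday A x α β

/-- The left-hand side `∇̄_μ (√(ε/μ) F̄^{μν})` of the source-free Maxwell equations in the medium,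
written in the optical spacetime. -/
def maxwell (A : Event → Fin 4 → ℂ) (ν : Fin 4) (x : Event) : ℂ :=
  M.divTensor (fun y α β => (√(M.eps y / M.mu y) : ℂ) * M.faradayUp A y α β) ν x

/-- The left-hand side `∇̄_μ Ā^μ` of the Lorenz gauge condition in the optical spacetime, where
`Ā^μ = ḡ^{μν} A_ν`. -/
def lorenz (A : Event → Fin 4 → ℂ) (x : Event) : ℂ :=
  M.div (fun y μ => ∑ ν, (M.gBar y μ ν : ℂ) * A y ν) x

/-- The potential `a_μ exp(i ω S)` of a wave with amplitude `a`, phase `S` and large parameter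
`ω`. -/
def wavePotential (S : Event → ℝ) (a : Event → Fin 4 → ℂ) (ω : ℝ) : Event → Fin 4 → ℂ :=
  fun x μ => a x μ * Complex.exp (Complex.I * ω * S x)

/-- `S` (the eikonal) and `a` (a nowhere vanishing amplitude) describe on the open set `N` a wave
in the geometrical optics approximation: the potential `a_μ exp(i ω S)` satisfies the source-free
Maxwell equations and the Lorenz gauge condition to leading order as `ω → ∞`. The leading orders
are `ω²` and `ω`; corrections of relative order `1/ω` to the amplitude do not contribute to
them. -/
structure IsGeometricalOpticsWave (N : Set Event) (S : Event → ℝ) (a : Event → Fin 4 → ℂ) :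
    Prop where
  isOpen : IsOpen N
  subset_region : N ⊆ M.region
  phase_contDiff : ContDiffOn ℝ 2 S N
  amplitude_contDiff : ∀ μ, ContDiffOn ℝ 2 (fun x => a x μ) N
  amplitude_ne_zero : ∀ x ∈ N, a x ≠ 0
  maxwell_eq : ∀ x ∈ N, ∀ ν,
    (fun ω : ℝ => M.maxwell (wavePotential S a ω) ν x) =o[atTop] (fun ω : ℝ => ω ^ 2)
  lorenz_eq : ∀ x ∈ N,
    (fun ω : ℝ => M.lorenz (wavePotential S a ω) x) =o[atTop] (fun ω : ℝ => ω)

/-- The wave covector `k_μ = ∂_μ S`. -/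
def waveCovector (S : Event → ℝ) (x : Event) (μ : Fin 4) : ℝ := partialDeriv μ S x

/-- The optical wave vector `k̄^μ = ḡ^{μν} k_ν`. -/
def waveVector (S : Event → ℝ) (x : Event) : Event :=
  fun μ => ∑ ν, M.gBar x μ ν * waveCovector S x ν

/-- `Γ : [0, 1] → spacetime` is a light ray, parametrized from its emission to its reception: near
each of its points it is a curve with tangent `k̄` for some wave of geometrical optics, and it is
future-directed (`ḡ(w, k̄) = w^μ k_μ > 0`). -/
def IsLightRay (Γ : ℝ → Event) : Prop :=
  ∀ s ∈ Icc (0 : ℝ) 1, ∃ (N : Set Event) (S : Event → ℝ) (a : Event → Fin 4 → ℂ),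
    Γ s ∈ N ∧ M.IsGeometricalOpticsWave N S a ∧
    0 < ∑ μ, M.w (Γ s) μ * waveCovector S (Γ s) μ ∧
    ∀ᶠ r in 𝓝[Icc 0 1] s, HasDerivWithinAt Γ (M.waveVector S (Γ r)) (Icc 0 1) r

/-- Some light ray emitted at the event `p` is received at the event `q`. -/
def LightConnected (p q : Event) : Prop :=
  ∃ Γ : ℝ → Event, M.IsLightRay Γ ∧ Γ 0 = p ∧ Γ 1 = q

/-- `T (𝐱_A, t_B, 𝐱_B)` is the reception time transfer function on `D`: light received at the event
`(c t_B, 𝐱_B)` has been emitted on the line `𝐱 = 𝐱_A` at one and only one event `(c t_A, 𝐱_A)`,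
the one with `t_B - t_A = T (𝐱_A, t_B, 𝐱_B)`. -/
def IsReceptionTimeTransfer (D : Set (Position × ℝ × Position))
    (T : Position → ℝ → Position → ℝ) : Prop :=
  ∀ xA tB xB, (xA, tB, xB) ∈ D → ∀ tA : ℝ,
    M.LightConnected (mkEvent (M.c * tA) xA) (mkEvent (M.c * tB) xB) ↔ tB - tA = T xA tB xB

/-- `T (t_A, 𝐱_A, 𝐱_B)` is the emission time transfer function on `D`: light emitted at the event
`(c t_A, 𝐱_A)` is received on the line `𝐱 = 𝐱_B` at one and only one event `(c t_B, 𝐱_B)`,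
the one with `t_B - t_A = T (t_A, 𝐱_A, 𝐱_B)`. -/
def IsEmissionTimeTransfer (D : Set (ℝ × Position × Position))
    (T : ℝ → Position → Position → ℝ) : Prop :=
  ∀ tA xA xB, (tA, xA, xB) ∈ D → ∀ tB : ℝ,
    M.LightConnected (mkEvent (M.c * tA) xA) (mkEvent (M.c * tB) xB) ↔ tB - tA = T tA xA xB

/-- The range transfer function `R_r(𝐱_A, x_B) = c T_r(𝐱_A, t_B, 𝐱_B)`. -/
def receptionRange (T : Position → ℝ → Position → ℝ) (xA : Position) (xB : Event) : ℝ :=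
  M.c * T xA (xB 0 / M.c) xB.position

/-- The range transfer function `R_e(x_A, 𝐱_B) = c T_e(t_A, 𝐱_A, 𝐱_B)`. -/
def emissionRange (T : ℝ → Position → Position → ℝ) (xA : Event) (xB : Position) : ℝ :=
  M.c * T (xA 0 / M.c) xA.position xB

end OpticalSpacetime

end

/-! Fix the event `P` common to all the rays and let `x⁰ = u(𝐱)` be the hypersurface of the other
endpoints. The equation claimed says that its conormal `(1, -∂_i u)` is null for the optical metric.

The ω² term of the Maxwell equations and the ω term of the gauge condition give `ḡ^{μν} k_μ k_ν =
0`. Differentiating this relation and using the symmetry of the Hessian of the phase, one lifts each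
light ray to a zero-level solution of the Hamilton equations of `½ ḡ^{μν} p_μ p_ν`
(`IsLightRay.exists_isNullHamiltonPath`). When the initial momentum varies over the null cone at
`P`, the endpoint moves at most linearly, and only to second order in the direction annihilated by
the final momentum (`IsNullHamiltonPath.endpoint_variation`): this is Huygens' principle.

Suppose the conormal is not null at one point, hence on a neighbourhood. The final momenta are null
and nonzero, so none is conormal to the graph, and each restricts to a nonzero functional on the
tangent space of the graph. This functional kills the displacement of the endpoint to first order.
The positions reached are thus locally parametrized by three coordinates of the initial momentum, in
a Lipschitz and everywhere degenerate way, and a Sard-type argument (`volume_eq_zero_of_flat`) makes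
them a null set. They fill a neighbourhood, a contradiction. Working with measure allows the rays to
be chosen arbitrarily, with no continuity in the endpoint. -/

/-! ### Sard-type criteria for null sets. -/

/-- If the functional `l` kills the increments of `f` to first order, the derivative of `f` may be
projected along a vector `e`; for `l e = 1` its range then lies in the kernel of `l`. -/
theorem HasFDerivWithinAt.sub_smulRight {E F : Type*} [NormedAddCommGroup E] [NormedSpace ℝ E]
    [NormedAddCommGroup F] [NormedSpace ℝ F] {f : E → F} {L : E →L[ℝ] F} {s : Set E} {a : E}
    (hf : HasFDerivWithinAt f L s a) {l : F →L[ℝ] ℝ}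
    (hl : (fun b => l (f b - f a)) =o[𝓝[s] a] fun b => b - a) (e : F) :
    HasFDerivWithinAt f (L - (l.comp L).smulRight e) s a := by
  rw [hasFDerivWithinAt_iff_isLittleO] at hf ⊢
  have h1 : (fun b => l (f b - f a - L (b - a))) =o[𝓝[s] a] fun b => b - a :=
    (l.isBigO_comp _ _).trans_isLittleO hf
  -- By linearity the scalar factor is `l (L (b - a))`, the correction subtracted from `L`.
  have h2 : (fun b => (l (f b - f a) - l (f b - f a - L (b - a))) • e) =o[𝓝[s] a]
      fun b => b - a :=
    ((ContinuousLinearMap.toSpanSingleton ℝ e).isBigO_comp _ _).trans_isLittleO (hl.sub h1)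
  refine (hf.add h2).congr_left fun b => ?_
  simp only [sub_apply, ContinuousLinearMap.smulRight_apply,
    ContinuousLinearMap.comp_apply, map_sub]
  module

theorem ContinuousLinearMap.det_eq_zero_of_comp_eq_zero {n : ℕ}
    (L : (Fin n → ℝ) →L[ℝ] (Fin n → ℝ)) {l : (Fin n → ℝ) →L[ℝ] ℝ} (hl : l ≠ 0)
    (h : l.comp L = 0) : L.det = 0 := by
  by_contra hd
  apply hl
  have hs : Function.Surjective L :=
    ((LinearMap.equivOfDetNeZero (L : (Fin n → ℝ) →ₗ[ℝ] (Fin n → ℝ)) hd)).surjective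
  ext1 y
  obtain ⟨x, rfl⟩ := hs y
  exact DFunLike.congr_fun h x

/-- Lebesgue measure is the `n`-dimensional Hausdorff measure for the sup norm, which a
`K`-Lipschitz map multiplies by at most `K ^ n`. -/
theorem LipschitzOnWith.volume_image_eq_zero {n : ℕ} {f : (Fin n → ℝ) → (Fin n → ℝ)}
    {K : NNReal} {s : Set (Fin n → ℝ)} (hf : LipschitzOnWith K f s)
    (hs : MeasureTheory.volume s = 0) : MeasureTheory.volume (f '' s) = 0 := by
  have h := hf.hausdorffMeasure_image_le (d := (Fintype.card (Fin n) : ℝ)) (by positivity)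
  rw [MeasureTheory.hausdorffMeasure_pi_real, hs, mul_zero] at h
  exact le_antisymm h (by positivity)

/-- A variant of the Sard theorem for Lipschitz maps: the image is null if, at each point, the
increments of the map are killed to first order by some nonzero functional. -/
theorem LipschitzOnWith.volume_image_eq_zero_of_flat {n : ℕ} {f : (Fin n → ℝ) → (Fin n → ℝ)}
    {K : NNReal} {s : Set (Fin n → ℝ)} (hf : LipschitzOnWith K f s)
    (h : ∀ a ∈ s, ∃ l : (Fin n → ℝ) →L[ℝ] ℝ, l ≠ 0 ∧
      (fun b => l (f b - f a)) =o[𝓝[s] a] fun b => b - a) :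
    MeasureTheory.volume (f '' s) = 0 := by
  set t := {a ∈ s | DifferentiableWithinAt ℝ f s a}
  -- Rademacher's theorem.
  have hst : MeasureTheory.volume (s \ t) = 0 := by
    have := hf.ae_differentiableWithinAt_of_mem (μ := MeasureTheory.volume)
    rw [MeasureTheory.ae_iff] at this
    refine MeasureTheory.measure_mono_null (fun a ha => ?_) this
    exact fun h' => ha.2 ⟨ha.1, h' ha.1⟩
  have hts : t ⊆ s := fun a ha => ha.1
  have key : ∀ a, ∃ L : (Fin n → ℝ) →L[ℝ] (Fin n → ℝ), a ∈ t →
      HasFDerivWithinAt f L t a ∧ L.det = 0 := by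
    intro a
    by_cases ha : a ∈ t
    swap
    · exact ⟨0, fun h => absurd h ha⟩
    obtain ⟨l, hl, hlo⟩ := h a ha.1
    obtain ⟨e, he⟩ : ∃ e, l e = 1 := by
      obtain ⟨v, hv⟩ : ∃ v, l v ≠ 0 := by
        by_contra! hc
        exact hl (ContinuousLinearMap.ext hc)
      exact ⟨(l v)⁻¹ • v, by simp [hv]⟩
    -- A derivative within `s` need not be unique, so `fderivWithin` may fail to satisfy `l ∘ L =
    -- 0`. Projecting it along `e` gives another derivative within `t` that does.
    refine ⟨_, fun _ => ⟨(ha.2.hasFDerivWithinAt.sub_smulRight hlo e).mono hts,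
      ContinuousLinearMap.det_eq_zero_of_comp_eq_zero _ hl ?_⟩⟩
    ext1 x
    simp [he]
  choose L hL using key
  have h1 := MeasureTheory.addHaar_image_eq_zero_of_det_fderivWithin_eq_zero MeasureTheory.volume
    (fun a ha => (hL a ha).1) (fun a ha => (hL a ha).2)
  have h2 := (hf.mono (sdiff_subset (t := t))).volume_image_eq_zero hst
  rw [← union_sdiff_cancel hts, image_union]
  exact MeasureTheory.measure_union_null h1 h2

/-- A set of points labelled by `k` is null if, near each of its points and in terms of a
coordinate `κ` of the label, the points depend on the label in a Lipschitz way, degenerate to first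
order. -/
theorem volume_eq_zero_of_flat {n : ℕ} {V : Type*} [PseudoMetricSpace V]
    [SecondCountableTopology V] {X : Set (Fin n → ℝ)} {k : (Fin n → ℝ) → V} {κ : V → (Fin n → ℝ)}
    (h1 : ∀ x ∈ X, ∃ C : ℝ, ∃ δ > 0, ∀ x' ∈ X, dist (k x') (k x) < δ →
      dist (k x') (k x) ≤ C * ‖κ (k x') - κ (k x)‖ ∧ ‖x' - x‖ ≤ C * ‖κ (k x') - κ (k x)‖)
    (h2 : ∀ x ∈ X, ∃ l : (Fin n → ℝ) →L[ℝ] ℝ, l ≠ 0 ∧ ∀ ε > 0, ∃ δ > 0, ∀ x' ∈ X,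
      dist (k x') (k x) < δ → |l (x' - x)| ≤ ε * ‖κ (k x') - κ (k x)‖) :
    MeasureTheory.volume X = 0 := by
  -- The constants `C`, `δ` depend on the point. Countably many pieces make them uniform, and balls
  -- of radius `1 / (2 * (N + 1))` in the label space bring any two points of a piece within the
  -- range of the estimate.
  set Y : ℕ → Set (Fin n → ℝ) := fun N => {x ∈ X | ∀ x' ∈ X, dist (k x') (k x) < 1 / (N + 1 : ℝ) →
      dist (k x') (k x) ≤ N * ‖κ (k x') - κ (k x)‖ ∧ ‖x' - x‖ ≤ N * ‖κ (k x') - κ (k x)‖}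
  obtain ⟨D, hDc, hD⟩ := TopologicalSpace.exists_countable_dense V
  have hcover : X ⊆ ⋃ N : ℕ, ⋃ c ∈ D, Y N ∩ k ⁻¹' Metric.ball c (1 / (2 * (N + 1 : ℝ))) := by
    intro x hx
    obtain ⟨C, δ, hδ, hC⟩ := h1 x hx
    obtain ⟨N₁, hN₁⟩ := exists_nat_ge C
    obtain ⟨N₂, hN₂⟩ := exists_nat_one_div_lt hδ
    set N := max N₁ N₂
    have hNδ : 1 / (N + 1 : ℝ) ≤ δ := by
      refine le_trans ?_ hN₂.le
      have : (N₂ : ℝ) ≤ N := by exact_mod_cast le_max_right _ _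
      gcongr
    have hNC : C ≤ N := hN₁.trans (by exact_mod_cast le_max_left _ _)
    obtain ⟨c, hc, hcD⟩ := hD.exists_dist_lt (k x) (ε := 1 / (2 * (N + 1 : ℝ))) (by positivity)
    simp only [mem_iUnion]
    refine ⟨N, c, hc, ⟨hx, fun x' hx' hd => ?_⟩, hcD⟩
    obtain ⟨ha, hb⟩ := hC x' hx' (hd.trans_le hNδ)
    exact ⟨ha.trans (by gcongr), hb.trans (by gcongr)⟩
  refine MeasureTheory.measure_mono_null hcover ?_
  refine MeasureTheory.measure_iUnion_null fun N => ?_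
  refine (MeasureTheory.measure_biUnion_null_iff hDc).2 fun c _ => ?_
  set Z := Y N ∩ k ⁻¹' Metric.ball c (1 / (2 * (N + 1 : ℝ)))
  have hZ : ∀ x ∈ Z, ∀ x' ∈ Z,
      dist (k x') (k x) ≤ N * ‖κ (k x') - κ (k x)‖ ∧ ‖x' - x‖ ≤ N * ‖κ (k x') - κ (k x)‖ := by
    intro x hx x' hx'
    refine hx.1.2 x' hx'.1.1 ?_
    calc dist (k x') (k x) ≤ dist (k x') c + dist (k x) c := dist_triangle_right _ _ _
      _ < 1 / (2 * (N + 1 : ℝ)) + 1 / (2 * (N + 1 : ℝ)) := add_lt_add hx'.2 hx.2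
      _ = 1 / (N + 1 : ℝ) := by field_simp; norm_num
  have hinj : InjOn (fun x => κ (k x)) Z := by
    intro x hx x' hx' he
    have := (hZ x hx x' hx').2
    simp only at he
    rw [he, sub_self, norm_zero, mul_zero] at this
    exact (sub_eq_zero.1 (norm_le_zero_iff.1 this)).symm
  -- The piece `Z` is the image of this inverse, a Lipschitz map between subsets of `ℝⁿ` to which
  -- the flat criterion applies.
  set f := Function.invFunOn (fun x => κ (k x)) Z
  have hf : ∀ x ∈ Z, f (κ (k x)) = x := fun x hx => hinj.leftInvOn_invFunOn hx
  have himg : f '' ((fun x => κ (k x)) '' Z) = Z := by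
    rw [image_image]
    exact (image_congr hf).trans (image_id' _)
  have hlip : LipschitzOnWith (N : NNReal) f ((fun x => κ (k x)) '' Z) := by
    refine LipschitzOnWith.of_dist_le_mul ?_
    rintro _ ⟨x, hx, rfl⟩ _ ⟨x', hx', rfl⟩
    simp only [hf x hx, hf x' hx', dist_eq_norm]
    exact (hZ x' hx' x hx).2
  rw [← himg]
  refine hlip.volume_image_eq_zero_of_flat ?_
  rintro _ ⟨x, hx, rfl⟩
  obtain ⟨l, hl, hlo⟩ := h2 x hx.1.1
  refine ⟨l, hl, Asymptotics.isLittleO_iff.2 fun ε hε => ?_⟩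
  obtain ⟨δ, hδ, hb⟩ := hlo ε hε
  have hmem : Metric.ball (κ (k x)) (δ / (N + 1)) ∈ 𝓝 (κ (k x)) :=
    Metric.ball_mem_nhds _ (by positivity)
  filter_upwards [self_mem_nhdsWithin, mem_nhdsWithin_of_mem_nhds hmem]
  rintro _ ⟨x', hx', rfl⟩ hd
  simp only [hf x hx, hf x' hx']
  refine hb x' hx'.1.1 ?_
  rw [mem_ball_iff_norm, lt_div_iff₀ (by positivity)] at hd
  have := (hZ x hx x' hx').1
  simp only at hd
  nlinarith [norm_nonneg (κ (k x') - κ (k x))]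

/-! ### Uniform Lipschitz and Taylor estimates. -/

/-- `C¹` maps are locally Lipschitz, and compactness makes the constants uniform. Only `p` has to
lie in `K`, so the estimate holds in a tube around an orbit. -/
theorem IsCompact.exists_forall_norm_sub_le_of_contDiffOn {E F : Type*} [NormedAddCommGroup E]
    [NormedSpace ℝ E] [NormedAddCommGroup F] [NormedSpace ℝ F] {K U : Set E} (hK : IsCompact K)
    (hU : IsOpen U) (hKU : K ⊆ U) {f : E → F} (hf : ContDiffOn ℝ 1 f U) :
    ∃ L ≥ (0 : ℝ), ∃ ε > (0 : ℝ), ∀ p ∈ K, ∀ q, ‖q - p‖ ≤ ε → q ∈ U ∧ ‖f q - f p‖ ≤ L * ‖q - p‖ := by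
  refine hK.induction_on (p := fun S => ∃ L ≥ (0 : ℝ), ∃ ε > (0 : ℝ), ∀ p ∈ S, ∀ q,
    ‖q - p‖ ≤ ε → q ∈ U ∧ ‖f q - f p‖ ≤ L * ‖q - p‖) ?_ ?_ ?_ ?_
  · exact ⟨0, le_rfl, 1, one_pos, fun p hp => hp.elim⟩
  · rintro s t hst ⟨L, hL, ε, hε, h⟩
    exact ⟨L, hL, ε, hε, fun p hp => h p (hst hp)⟩
  · rintro s t ⟨L, hL, ε, hε, h⟩ ⟨L', hL', ε', hε', h'⟩
    refine ⟨max L L', le_max_of_le_left hL, min ε ε', lt_min hε hε', ?_⟩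
    rintro p (hp | hp) q hq
    · obtain ⟨h1, h2⟩ := h p hp q (hq.trans (min_le_left _ _))
      exact ⟨h1, h2.trans (by gcongr; exact le_max_left _ _)⟩
    · obtain ⟨h1, h2⟩ := h' p hp q (hq.trans (min_le_right _ _))
      exact ⟨h1, h2.trans (by gcongr; exact le_max_right _ _)⟩
  · intro p hp
    have hUp : U ∈ 𝓝 p := hU.mem_nhds (hKU hp)
    obtain ⟨L, t, ht, hLt⟩ := (hf.contDiffAt hUp).exists_lipschitzOnWith
    obtain ⟨r, hr, hrt⟩ := Metric.mem_nhds_iff.1 (inter_mem ht hUp)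
    refine ⟨Metric.ball p (r / 2),
      mem_nhdsWithin_of_mem_nhds (Metric.ball_mem_nhds _ (by positivity)),
      L, L.2, r / 2, by positivity, fun p' hp' q hq => ?_⟩
    have hp2 : p' ∈ t ∩ U := hrt (Metric.ball_subset_ball (by linarith) hp')
    have hq2 : q ∈ t ∩ U := by
      refine hrt ?_
      rw [← dist_eq_norm] at hq
      rw [Metric.mem_ball] at hp' ⊢
      linarith [dist_triangle q p' p]
    exact ⟨hq2.2, hLt.norm_sub_le hq2.1 hp2.1⟩

/-- If the derivative is Lipschitz around `p`, the first-order Taylor remainder is quadratic. -/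
theorem norm_sub_sub_fderiv_le {E F : Type*} [NormedAddCommGroup E]
    [NormedSpace ℝ E] [NormedAddCommGroup F] [NormedSpace ℝ F] {f : E → F} {L ε : ℝ} {p q : E}
    (hd : ∀ q, ‖q - p‖ ≤ ε → DifferentiableAt ℝ f q)
    (h : ∀ q, ‖q - p‖ ≤ ε → ‖fderiv ℝ f q - fderiv ℝ f p‖ ≤ L * ‖q - p‖) (hL : 0 ≤ L)
    (hq : ‖q - p‖ ≤ ε) : ‖f q - f p - fderiv ℝ f p (q - p)‖ ≤ L * ‖q - p‖ * ‖q - p‖ := by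
  have hball : ∀ x ∈ Metric.closedBall p ‖q - p‖, ‖x - p‖ ≤ ‖q - p‖ := fun x hx => by
    rwa [mem_closedBall_iff_norm] at hx
  refine (convex_closedBall p ‖q - p‖).norm_image_sub_le_of_norm_fderiv_le'
    (fun x hx => hd x ((hball x hx).trans hq)) (fun x hx => ?_) (by simp) (by simp [dist_eq_norm])
  exact (h x ((hball x hx).trans hq)).trans (by gcongr; exact hball x hx)

/-! ### Null Hamilton paths and the variation of their endpoints. -/

section HamiltonPath

variable {m : ℕ}

/-- The Hamiltonian vector with given differential of the Hamiltonian. -/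
def hamiltonVector (L : (Fin m → ℝ) × (Fin m → ℝ) →L[ℝ] ℝ) : (Fin m → ℝ) × (Fin m → ℝ) :=
  (fun i => L (0, Pi.single i 1), fun i => -L (Pi.single i 1, 0))

theorem hamiltonVector_sub (L L' : (Fin m → ℝ) × (Fin m → ℝ) →L[ℝ] ℝ) :
    hamiltonVector (L - L') = hamiltonVector L - hamiltonVector L' := by
  ext i
  · simp [hamiltonVector]
  · simp [hamiltonVector]; ring

theorem norm_hamiltonVector_le (L : (Fin m → ℝ) × (Fin m → ℝ) →L[ℝ] ℝ) :
    ‖hamiltonVector L‖ ≤ ‖L‖ := by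
  refine max_le ((pi_norm_le_iff_of_nonneg (norm_nonneg _)).2 fun i => ?_)
    ((pi_norm_le_iff_of_nonneg (norm_nonneg _)).2 fun i => ?_)
  · refine (L.le_opNorm _).trans (mul_le_of_le_one_right (norm_nonneg _) ?_)
    simp [Prod.norm_def, Pi.norm_single]
  · simp only [hamiltonVector, norm_neg]
    refine (L.le_opNorm _).trans (mul_le_of_le_one_right (norm_nonneg _) ?_)
    simp [Prod.norm_def, Pi.norm_single]

theorem sum_mul_hamiltonVector_fst (L : (Fin m → ℝ) × (Fin m → ℝ) →L[ℝ] ℝ) (ξ : Fin m → ℝ) :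
    ∑ i, ξ i * (hamiltonVector L).1 i = L (0, ξ) := by
  have h : ((0 : Fin m → ℝ), ξ) = ∑ i, ξ i • ((0 : Fin m → ℝ), (Pi.single i 1 : Fin m → ℝ)) := by
    ext j
    · simp [Prod.fst_sum]
    · simp [Prod.snd_sum, Finset.sum_apply, Pi.single_apply]
  rw [h, map_sum]
  simp only [map_smul, smul_eq_mul, hamiltonVector]

theorem sum_hamiltonVector_snd_mul (L : (Fin m → ℝ) × (Fin m → ℝ) →L[ℝ] ℝ) (u : Fin m → ℝ) :
    ∑ i, (hamiltonVector L).2 i * u i = -L (u, 0) := by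
  have h : (u, (0 : Fin m → ℝ)) = ∑ i, u i • ((Pi.single i 1 : Fin m → ℝ), (0 : Fin m → ℝ)) := by
    ext j
    · simp [Prod.fst_sum, Finset.sum_apply, Pi.single_apply]
    · simp [Prod.snd_sum]
  rw [h, map_sum]
  simp only [map_smul, smul_eq_mul, hamiltonVector, neg_mul, Finset.sum_neg_distrib, mul_comm (u _)]

/-- `z : [0, 1] → U` is a solution of the Hamilton equations of `h` on its zero level. -/
def IsNullHamiltonPath (h : (Fin m → ℝ) × (Fin m → ℝ) → ℝ) (U : Set ((Fin m → ℝ) × (Fin m → ℝ)))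
    (z : ℝ → (Fin m → ℝ) × (Fin m → ℝ)) : Prop :=
  ∀ s ∈ Icc (0 : ℝ) 1, z s ∈ U ∧ h (z s) = 0 ∧
    HasDerivWithinAt z (hamiltonVector (fderiv ℝ h (z s))) (Icc 0 1) s

theorem IsNullHamiltonPath.continuousOn {h : (Fin m → ℝ) × (Fin m → ℝ) → ℝ}
    {U : Set ((Fin m → ℝ) × (Fin m → ℝ))} {z : ℝ → (Fin m → ℝ) × (Fin m → ℝ)}
    (hz : IsNullHamiltonPath h U z) : ContinuousOn z (Icc 0 1) :=
  fun s hs => (hz s hs).2.2.continuousWithinAt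

/-- A Gronwall estimate near a given integral curve, for a vector field that is Lipschitz along
this curve. -/
theorem norm_sub_le_of_lipschitz_along {E : Type*} [NormedAddCommGroup E] [NormedSpace ℝ E]
    {X : E → E} {z z' : ℝ → E} {L ε : ℝ} (hL : 0 ≤ L)
    (hz : ∀ s ∈ Icc (0 : ℝ) 1, HasDerivWithinAt z (X (z s)) (Icc 0 1) s)
    (hz' : ∀ s ∈ Icc (0 : ℝ) 1, HasDerivWithinAt z' (X (z' s)) (Icc 0 1) s)
    (hX : ∀ s ∈ Icc (0 : ℝ) 1, ∀ q, ‖q - z s‖ ≤ ε → ‖X q - X (z s)‖ ≤ L * ‖q - z s‖)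
    (h0 : ‖z' 0 - z 0‖ * Real.exp (L + 1) < ε) :
    ∀ s ∈ Icc (0 : ℝ) 1, ‖z' s - z s‖ ≤ ‖z' 0 - z 0‖ * Real.exp (L + 1) := by
  -- The barrier argument needs a strict inequality of derivatives at contact. The exponent `L + 1`
  -- instead of `L`, with `b > 0`, provides it even when the initial points coincide. At contact the
  -- distance equals the barrier, hence is below `ε`, so Lipschitz control in the tube is enough.
  have key : ∀ b, ‖z' 0 - z 0‖ < b → b * Real.exp (L + 1) < ε → ∀ s ∈ Icc (0 : ℝ) 1,
      ‖z' s - z s‖ ≤ b * Real.exp (L + 1) := by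
    intro b hb hbε s hs
    have hb0 : 0 < b := (norm_nonneg _).trans_lt hb
    have hexp : ∀ x ∈ Icc (0 : ℝ) 1, b * Real.exp ((L + 1) * x) ≤ b * Real.exp (L + 1) := by
      intro x hx
      gcongr
      nlinarith [hx.2]
    refine le_trans ?_ (hexp s hs)
    refine image_norm_le_of_norm_deriv_right_lt_deriv_boundary (a := 0) (b := 1)
      (f := fun s => z' s - z s) (f' := fun s => X (z' s) - X (z s))
      (B := fun s => b * Real.exp ((L + 1) * s))
      (B' := fun s => b * (Real.exp ((L + 1) * s) * (L + 1)))
      (fun s hs => ((hz' s hs).sub (hz s hs)).continuousWithinAt) (fun s hs => ?_)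
      (by simpa using hb.le) (fun s => ?_) (fun s hs he => ?_) hs
    · refine ((hz' s (Ico_subset_Icc_self hs)).sub
        (hz s (Ico_subset_Icc_self hs))).mono_of_mem_nhdsWithin ?_
      exact mem_of_superset (Icc_mem_nhdsGE hs.2) (Icc_subset_Icc hs.1 le_rfl)
    · exact (((hasDerivAt_id s).const_mul (L + 1)).exp.const_mul b).congr_deriv (by simp)
    · have hs' := Ico_subset_Icc_self hs
      have h1 : ‖z' s - z s‖ ≤ ε := by
        rw [he]
        exact (hexp s hs').trans hbε.le
      refine (hX s hs' _ h1).trans_lt ?_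
      rw [he]
      have : 0 < b * Real.exp ((L + 1) * s) := by positivity
      nlinarith
  intro s hs
  set e := Real.exp (L + 1)
  have he : 0 < e := Real.exp_pos _
  set d := ‖z' 0 - z 0‖
  by_contra! hc
  obtain ⟨y, hy1, hy2⟩ := exists_between (lt_min hc h0)
  have h1 := key (y / e) ((lt_div_iff₀ he).2 hy1)
    (by rw [div_mul_cancel₀ _ he.ne']; exact hy2.trans_le (min_le_right _ _)) s hs
  rw [div_mul_cancel₀ _ he.ne'] at h1
  exact absurd (hy2.trans_le (min_le_left _ _)) (not_lt.2 h1)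

/-- First variation of the endpoint of a null Hamilton path with the momentum at its origin: it is
at most linear, and at most quadratic in the direction of the final momentum. -/
theorem IsNullHamiltonPath.endpoint_variation {h : (Fin m → ℝ) × (Fin m → ℝ) → ℝ}
    {U : Set ((Fin m → ℝ) × (Fin m → ℝ))} (hU : IsOpen U) (hh : ContDiffOn ℝ 2 h U)
    (hom : ∀ z ∈ U, h z = 0 → fderiv ℝ h z (0, z.2) = 0)
    {z : ℝ → (Fin m → ℝ) × (Fin m → ℝ)} (hz : IsNullHamiltonPath h U z) :
    ∃ C, ∃ δ > 0, ∀ z', IsNullHamiltonPath h U z' → (z' 0).1 = (z 0).1 →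
      ‖(z' 0).2 - (z 0).2‖ < δ →
      ‖(z' 1).1 - (z 1).1‖ ≤ C * ‖(z' 0).2 - (z 0).2‖ ∧
      |∑ i, (z 1).2 i * ((z' 1).1 i - (z 1).1 i)| ≤ C * ‖(z' 0).2 - (z 0).2‖ ^ 2 := by
  have hK : IsCompact (z '' Icc 0 1) := isCompact_Icc.image_of_continuousOn hz.continuousOn
  have hKU : z '' Icc 0 1 ⊆ U := by
    rintro _ ⟨s, hs, rfl⟩
    exact (hz s hs).1
  obtain ⟨L, hL, ε, hε, hLε⟩ := hK.exists_forall_norm_sub_le_of_contDiffOn hU hKU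
    (hh.fderiv_of_isOpen hU (m := 1) (by norm_num))
  have hLε' : ∀ s ∈ Icc (0 : ℝ) 1, ∀ q, ‖q - z s‖ ≤ ε →
      q ∈ U ∧ ‖fderiv ℝ h q - fderiv ℝ h (z s)‖ ≤ L * ‖q - z s‖ :=
    fun s hs => hLε _ (mem_image_of_mem _ hs)
  set e := Real.exp (L + 1)
  have he : 0 < e := Real.exp_pos _
  -- The term `e` serves the linear bound and `2 * L * e ^ 2` the quadratic one. The radius `ε / e`
  -- keeps `z'` in the tube by Gronwall.
  refine ⟨e + 2 * L * e ^ 2, ε / e, by positivity, fun z' hz' h1 h2 => ?_⟩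
  set d := ‖(z' 0).2 - (z 0).2‖
  have hd0 : 0 ≤ d := norm_nonneg _
  have hd : ‖z' 0 - z 0‖ = d := by
    simp [Prod.norm_def, h1, d]
  have hgron : ∀ s ∈ Icc (0 : ℝ) 1, ‖z' s - z s‖ ≤ d * e := by
    have := norm_sub_le_of_lipschitz_along (X := fun q => hamiltonVector (fderiv ℝ h q)) hL
      (fun s hs => (hz s hs).2.2) (fun s hs => (hz' s hs).2.2) (ε := ε) (fun s hs q hq => by
        rw [← hamiltonVector_sub]
        exact (norm_hamiltonVector_le _).trans (hLε' s hs q hq).2)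
      (by rw [hd]; exact (lt_div_iff₀ he).1 h2)
    rwa [hd] at this
  have hde : d * e ≤ ε := ((lt_div_iff₀ he).1 h2).le
  have hx : ∀ s ∈ Icc (0 : ℝ) 1, HasDerivWithinAt
      (fun s => ∑ i, (z s).2 i * ((z' s).1 i - (z s).1 i))
      (∑ i, ((hamiltonVector (fderiv ℝ h (z s))).2 i * ((z' s).1 i - (z s).1 i) +
        (z s).2 i * ((hamiltonVector (fderiv ℝ h (z' s))).1 i
          - (hamiltonVector (fderiv ℝ h (z s))).1 i))) (Icc 0 1) s := by
    intro s hs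
    have h1 := (hz s hs).2.2
    have h2 := (hz' s hs).2.2
    refine HasDerivWithinAt.fun_sum fun i _ => ?_
    have a1 : HasDerivWithinAt (fun s => (z s).1 i) _ (Icc 0 1) s :=
      hasDerivWithinAt_pi.1 h1.fst i
    have a2 : HasDerivWithinAt (fun s => (z s).2 i) _ (Icc 0 1) s :=
      hasDerivWithinAt_pi.1 h1.snd i
    have a3 : HasDerivWithinAt (fun s => (z' s).1 i) _ (Icc 0 1) s :=
      hasDerivWithinAt_pi.1 h2.fst i
    exact a2.mul (a3.sub a1)
  have hbound : ∀ s ∈ Icc (0 : ℝ) 1,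
      ‖∑ i, ((hamiltonVector (fderiv ℝ h (z s))).2 i * ((z' s).1 i - (z s).1 i) +
        (z s).2 i * ((hamiltonVector (fderiv ℝ h (z' s))).1 i
          - (hamiltonVector (fderiv ℝ h (z s))).1 i))‖ ≤ 2 * L * (d * e) ^ 2 := by
    intro s hs
    set D := fderiv ℝ h (z s)
    set D' := fderiv ℝ h (z' s)
    have hq := hgron s hs
    have e1 : ∑ i, (hamiltonVector D).2 i * ((z' s).1 i - (z s).1 i)
        = -D ((z' s).1 - (z s).1, 0) := sum_hamiltonVector_snd_mul D ((z' s).1 - (z s).1)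
    have e2 : D (0, (z s).2) = 0 := hom _ (hz s hs).1 (hz s hs).2.1
    have e3 : D' (0, (z' s).2) = 0 := hom _ (hz' s hs).1 (hz' s hs).2.1
    have e4 : D' (0, (z s).2) = -D' (0, (z' s).2 - (z s).2) := by
      have : ((0 : Fin m → ℝ), (z' s).2 - (z s).2) = (0, (z' s).2) - (0, (z s).2) := by simp
      rw [this, map_sub, e3]
      ring
    have e5 : D (z' s - z s) = D ((z' s).1 - (z s).1, 0) + D (0, (z' s).2 - (z s).2) := by
      rw [← map_add, Prod.mk_add_mk, add_zero, zero_add]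
      rfl
    -- The derivative of the pairing has no first-order part: since `D (0, p) = 0` along both paths
    -- and `h` vanishes on them, only a Taylor remainder of `h` and a difference of derivatives
    -- applied to the increment of momentum are left, both quadratic.
    have e6 : ∑ i, ((hamiltonVector D).2 i * ((z' s).1 i - (z s).1 i) +
        (z s).2 i * ((hamiltonVector D').1 i - (hamiltonVector D).1 i))
        = (h (z' s) - h (z s) - D (z' s - z s)) - (D' - D) (0, (z' s).2 - (z s).2) := by
      simp only [mul_sub, Finset.sum_add_distrib, Finset.sum_sub_distrib,
        sum_mul_hamiltonVector_fst]
      simp only [mul_sub, Finset.sum_sub_distrib] at e1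
      rw [e1, e2, e4, e5, (hz s hs).2.1, (hz' s hs).2.1, sub_apply]
      ring
    rw [e6]
    have b1 := norm_sub_sub_fderiv_le (f := h) (p := z s) (q := z' s)
      (fun q hq => ((hh.contDiffAt (hU.mem_nhds (hLε' s hs q hq).1)).differentiableAt (by norm_num)))
      (fun q hq => (hLε' s hs q hq).2) hL (hq.trans hde)
    have b2 : ‖(D' - D) (0, (z' s).2 - (z s).2)‖ ≤ L * ‖z' s - z s‖ * ‖z' s - z s‖ := by
      refine ((D' - D).le_opNorm _).trans ?_
      gcongr
      · exact (hLε' s hs _ (hq.trans hde)).2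
      · simp [Prod.norm_def]
    have b3 : L * ‖z' s - z s‖ * ‖z' s - z s‖ ≤ L * (d * e) * (d * e) := by gcongr
    refine (norm_sub_le _ _).trans ?_
    linarith
  have hone : (1 : ℝ) ∈ Icc (0 : ℝ) 1 := ⟨zero_le_one, le_rfl⟩
  constructor
  · have : ‖(z' 1).1 - (z 1).1‖ ≤ ‖z' 1 - z 1‖ := norm_fst_le (z' 1 - z 1)
    refine (this.trans (hgron 1 hone)).trans ?_
    have : 0 ≤ 2 * L * e ^ 2 * d := by positivity
    linarith
  · have := norm_image_sub_le_of_norm_deriv_le_segment' hx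
      (fun s hs => hbound s (Ico_subset_Icc_self hs)) 1 hone
    simp only [h1, sub_self, mul_zero, Finset.sum_const_zero, sub_zero, mul_one,
      Real.norm_eq_abs] at this
    refine this.trans ?_
    have : 0 ≤ e * d ^ 2 := by positivity
    nlinarith

end HamiltonPath

/-! ### The optical metric and its Hamiltonian. -/

namespace OpticalSpacetime

variable (M : OpticalSpacetime)

theorem c_pos : 0 < M.c :=
  inv_pos.2 (Real.sqrt_pos.2 (mul_pos M.eps0_pos M.mu0_pos))

theorem n_sq {x : Event} (hx : x ∈ M.region) :
    M.n x ^ 2 = M.eps x * M.mu x / (M.eps0 * M.mu0) := by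
  rw [n, c, mul_pow, inv_pow, Real.sq_sqrt (mul_pos M.eps0_pos M.mu0_pos).le,
    Real.sq_sqrt (mul_pos (M.eps_pos x hx) (M.mu_pos x hx)).le]
  ring

theorem n_sq_pos {x : Event} (hx : x ∈ M.region) : 0 < M.n x ^ 2 := by
  rw [M.n_sq hx]
  exact div_pos (mul_pos (M.eps_pos x hx) (M.mu_pos x hx)) (mul_pos M.eps0_pos M.mu0_pos)

theorem isUnit_det_g {x : Event} (hx : x ∈ M.region) : IsUnit (M.g x).det := by
  obtain ⟨P, -, h⟩ := M.g_signature x hx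
  have h1 := congrArg Matrix.det h
  rw [Matrix.det_mul, Matrix.det_mul, Matrix.det_diagonal] at h1
  refine isUnit_iff_ne_zero.2 fun h0 => ?_
  rw [h0, mul_zero, zero_mul] at h1
  simp [Fin.prod_univ_four] at h1

/-- Sherman–Morrison formula for a rank-one perturbation of `g`, with `w_μ w^μ = 1`. -/
theorem gBarLow_mul_gBar {x : Event} (hx : x ∈ M.region) : M.gBarLow x * M.gBar x = 1 := by
  have hu := M.isUnit_det_g hx
  have hs : (M.g x).transpose = M.g x := M.g_symm x hx
  have hn := M.n_sq_pos hx
  have hwl : M.wLow x = (M.g x).mulVec (M.w x) := rfl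
  have h1 : M.gBarLow x
      = M.g x - (1 - 1 / M.n x ^ 2) • Matrix.vecMulVec (M.wLow x) (M.wLow x) := by
    ext μ ν
    simp [gBarLow, Matrix.vecMulVec_apply, mul_assoc]
  have h2 : M.gBar x = (M.g x)⁻¹ + (M.n x ^ 2 - 1) • Matrix.vecMulVec (M.w x) (M.w x) := by
    ext μ ν
    simp [gBar, Matrix.vecMulVec_apply, mul_assoc]
  have h3 : Matrix.vecMul (M.wLow x) (M.g x)⁻¹ = M.w x := by
    rw [hwl]
    nth_rw 1 [← hs]
    rw [Matrix.mulVec_transpose, Matrix.vecMul_vecMul, Matrix.mul_nonsing_inv _ hu,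
      Matrix.vecMul_one]
  have h4 : M.wLow x ⬝ᵥ M.w x = 1 := by
    rw [← M.w_unit x hx]
    simp only [dotProduct, wLow, Finset.sum_mul]
    refine Finset.sum_congr rfl fun μ _ => Finset.sum_congr rfl fun ν _ => by ring
  rw [h1, h2, sub_mul, mul_add, mul_add, Matrix.mul_nonsing_inv _ hu, Matrix.mul_smul,
    Matrix.smul_mul, Matrix.smul_mul, Matrix.mul_smul, Matrix.mul_vecMulVec, ← hwl,
    Matrix.vecMulVec_mul, h3, Matrix.vecMulVec_mul_vecMulVec, h4, one_smul]
  have h5 : (M.n x ^ 2 - 1) - (1 - 1 / M.n x ^ 2) - (1 - 1 / M.n x ^ 2) * (M.n x ^ 2 - 1) = 0 := by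
    generalize M.n x ^ 2 = q at hn
    field_simp
    ring
  have h6 : ∀ V : Matrix (Fin 4) (Fin 4) ℝ, 1 + (M.n x ^ 2 - 1) • V
      - ((1 - 1 / M.n x ^ 2) • V + (1 - 1 / M.n x ^ 2) • (M.n x ^ 2 - 1) • V)
      = 1 + ((M.n x ^ 2 - 1) - (1 - 1 / M.n x ^ 2)
        - (1 - 1 / M.n x ^ 2) * (M.n x ^ 2 - 1)) • V := fun V => by module
  rw [h6, h5, zero_smul, add_zero]

theorem gBar_comm {x : Event} (hx : x ∈ M.region) (μ ν : Fin 4) :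
    M.gBar x μ ν = M.gBar x ν μ := by
  have h : ((M.g x)⁻¹).transpose = (M.g x)⁻¹ := by
    rw [Matrix.transpose_nonsing_inv, M.g_symm x hx]
  have h' : (M.g x)⁻¹ μ ν = (M.g x)⁻¹ ν μ := by
    conv_lhs => rw [← h]
    rfl
  rw [gBar, gBar, h']
  ring

/-- The inverse of `g` is smooth enough by Cramer's rule. The 4-velocity need not be continuous, so
the rank-one term is taken as a whole from `kappa_contDiff`. -/
theorem contDiffOn_gBar (μ ν : Fin 4) : ContDiffOn ℝ 2 (fun x => M.gBar x μ ν) M.region := by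
  have hdet : ∀ A : Event → Matrix (Fin 4) (Fin 4) ℝ,
      (∀ i j, ContDiffOn ℝ 2 (fun x => A x i j) M.region) →
      ContDiffOn ℝ 2 (fun x => (A x).det) M.region := by
    intro A hA
    simp only [Matrix.det_apply']
    exact ContDiffOn.sum fun σ _ => contDiffOn_const.mul (contDiffOn_prod fun i _ => hA _ _)
  have h1 : ContDiffOn ℝ 2 (fun x => (M.g x).det⁻¹ * (M.g x).adjugate μ ν) M.region := by
    refine ((hdet _ M.g_contDiff).inv fun x hx => (M.isUnit_det_g hx).ne_zero).mul ?_
    simp only [Matrix.adjugate_apply]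
    refine hdet _ fun i j => ?_
    by_cases hi : i = ν
    · subst hi
      simpa using contDiffOn_const
    · simpa [Matrix.updateRow_ne hi] using M.g_contDiff i j
  refine (h1.add (M.kappa_contDiff μ ν)).congr fun x hx => ?_
  rw [gBar, Matrix.inv_def, Ring.inverse_eq_inv', M.n_sq hx]
  simp only [Matrix.smul_apply, smul_eq_mul]
  ring

/-- The Hamiltonian `½ ḡ^{μν}(x) p_μ p_ν` of geometrical optics. -/
noncomputable def hamiltonian (z : Event × Event) : ℝ :=
  1 / 2 * ∑ μ, ∑ ν, M.gBar z.1 μ ν * z.2 μ * z.2 ν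

/-- The phase space over the coordinate domain. -/
def phaseSpace : Set (Event × Event) := M.region ×ˢ univ

theorem isOpen_phaseSpace : IsOpen M.phaseSpace := M.isOpen_region.prod isOpen_univ

theorem contDiffOn_hamiltonian : ContDiffOn ℝ 2 M.hamiltonian M.phaseSpace := by
  refine contDiffOn_const.mul (ContDiffOn.sum fun μ _ => ContDiffOn.sum fun ν _ => ?_)
  have h : ∀ i : Fin 4, ContDiffOn ℝ 2 (fun z : Event × Event => z.2 i) M.phaseSpace := fun i =>
    ((contDiff_apply ℝ ℝ i).comp contDiff_snd).contDiffOn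
  exact (((M.contDiffOn_gBar μ ν).comp contDiff_fst.contDiffOn fun z hz => hz.1).mul
    (h μ)).mul (h ν)

theorem differentiableAt_hamiltonian {z : Event × Event} (hz : z.1 ∈ M.region) :
    DifferentiableAt ℝ M.hamiltonian z :=
  (M.contDiffOn_hamiltonian.contDiffAt
    (M.isOpen_phaseSpace.mem_nhds ⟨hz, mem_univ _⟩)).differentiableAt (by norm_num)

theorem hamiltonian_add_smul {x : Event} (hx : x ∈ M.region) (p ξ : Event) (t : ℝ) :
    M.hamiltonian (x, p + t • ξ) = M.hamiltonian (x, p)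
      + t * (∑ μ, ξ μ * ∑ ν, M.gBar x μ ν * p ν) + t ^ 2 * M.hamiltonian (x, ξ) := by
  have hcomm : ∑ μ, ∑ ν, M.gBar x μ ν * p μ * ξ ν = ∑ μ, ∑ ν, M.gBar x μ ν * ξ μ * p ν := by
    rw [Finset.sum_comm]
    refine Finset.sum_congr rfl fun μ _ => Finset.sum_congr rfl fun ν _ => ?_
    rw [M.gBar_comm hx]
    ring
  have h1 : ∑ μ, ξ μ * ∑ ν, M.gBar x μ ν * p ν
      = 1 / 2 * (∑ μ, ∑ ν, M.gBar x μ ν * p μ * ξ ν + ∑ μ, ∑ ν, M.gBar x μ ν * ξ μ * p ν) := by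
    rw [hcomm, ← two_mul, ← mul_assoc]
    norm_num
    simp only [Finset.mul_sum]
    refine Finset.sum_congr rfl fun μ _ => Finset.sum_congr rfl fun ν _ => by ring
  rw [h1]
  simp only [hamiltonian, Finset.mul_sum, ← Finset.sum_add_distrib, Pi.add_apply, Pi.smul_apply,
    smul_eq_mul]
  refine Finset.sum_congr rfl fun μ _ => Finset.sum_congr rfl fun ν _ => by ring

theorem fderiv_hamiltonian_snd {x : Event} (hx : x ∈ M.region) (p ξ : Event) :
    fderiv ℝ M.hamiltonian (x, p) (0, ξ) = ∑ μ, ξ μ * ∑ ν, M.gBar x μ ν * p ν := by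
  have h1 : HasDerivAt (fun t : ℝ => M.hamiltonian ((x, p) + t • ((0 : Event), ξ)))
      (fderiv ℝ M.hamiltonian (x, p) (0, ξ)) 0 :=
    (M.differentiableAt_hamiltonian (z := (x, p)) hx).hasFDerivAt.hasLineDerivAt _
  have h2 : (fun t : ℝ => M.hamiltonian ((x, p) + t • ((0 : Event), ξ)))
      = fun t => M.hamiltonian (x, p) + t * (∑ μ, ξ μ * ∑ ν, M.gBar x μ ν * p ν)
        + t ^ 2 * M.hamiltonian (x, ξ) := by
    funext t
    rw [← M.hamiltonian_add_smul hx]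
    simp
  rw [h2] at h1
  refine h1.unique ?_
  have := (((hasDerivAt_id (0 : ℝ)).mul_const (∑ μ, ξ μ * ∑ ν, M.gBar x μ ν * p ν)).const_add
    (M.hamiltonian (x, p))).add ((hasDerivAt_pow 2 (0 : ℝ)).mul_const (M.hamiltonian (x, ξ)))
  exact this.congr_deriv (by simp)

/-- Euler's identity in the momenta. On the zero level it gives the hypothesis `hom` of
`IsNullHamiltonPath.endpoint_variation`. -/
theorem fderiv_hamiltonian_self {z : Event × Event} (hz : z ∈ M.phaseSpace) :
    fderiv ℝ M.hamiltonian z (0, z.2) = 2 * M.hamiltonian z := by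
  rw [show z = (z.1, z.2) from rfl, M.fderiv_hamiltonian_snd hz.1, hamiltonian, ← mul_assoc]
  norm_num
  simp only [Finset.mul_sum]
  refine Finset.sum_congr rfl fun μ _ => Finset.sum_congr rfl fun ν _ => by ring

theorem hamiltonVector_hamiltonian_fst {x : Event} (hx : x ∈ M.region) (p : Event) :
    (hamiltonVector (fderiv ℝ M.hamiltonian (x, p))).1 = fun μ => ∑ ν, M.gBar x μ ν * p ν := by
  funext μ
  refine (M.fderiv_hamiltonian_snd hx p _).trans ?_
  simp [Pi.single_apply]

/-- Raising the index with the optical metric is injective. -/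
theorem eq_zero_of_gBar_sum_eq_zero {x : Event} (hx : x ∈ M.region) {a : Fin 4 → ℂ}
    (h : ∀ μ, ∑ ν, (M.gBar x μ ν : ℂ) * a ν = 0) : a = 0 := by
  have h1 : ((M.gBarLow x).map Complex.ofRealHom * (M.gBar x).map Complex.ofRealHom) = 1 := by
    rw [← Matrix.map_mul, M.gBarLow_mul_gBar hx, Matrix.map_one _ (map_zero _) (map_one _)]
  have h2 : ((M.gBar x).map Complex.ofRealHom).mulVec a = 0 := funext h
  rw [← Matrix.one_mulVec a, ← h1, ← Matrix.mulVec_mulVec, h2, Matrix.mulVec_zero]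

end OpticalSpacetime

/-! ### High-frequency expansion and the dispersion relation. -/

theorem eq_zero_of_quadratic_isLittleO {u : ℝ → ℂ} (hu : ∀ ω, ‖u ω‖ = 1) {c₀ c₁ c₂ : ℂ}
    (h : (fun ω : ℝ => (c₀ + c₁ * ω + c₂ * ω ^ 2) * u ω) =o[atTop] fun ω : ℝ => ω ^ 2) :
    c₂ = 0 := by
  have h1 : (fun ω : ℝ => c₀ + c₁ * ω + c₂ * ω ^ 2) =o[atTop] fun ω : ℝ => ω ^ 2 :=
    h.norm_left.congr_left (fun ω => by rw [norm_mul, hu, mul_one]) |>.of_norm_left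
  have hcast : ∀ ω : ℝ, ‖(ω : ℂ)‖ = ‖ω‖ := fun ω => by simp
  have h0 : (fun _ : ℝ => c₀) =o[atTop] fun ω : ℝ => ω ^ 2 :=
    Asymptotics.isLittleO_const_left.2 (Or.inr
      (tendsto_norm_atTop_atTop.comp (tendsto_pow_atTop two_ne_zero)))
  have h2 : (fun ω : ℝ => c₁ * ω) =o[atTop] fun ω : ℝ => ω ^ 2 := by
    have : (fun ω : ℝ => ω) =o[atTop] fun ω : ℝ => ω ^ 2 := by
      simpa using Asymptotics.isLittleO_pow_pow_atTop_of_lt (𝕜 := ℝ) (p := 1) (q := 2) one_lt_two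
    exact ((this.norm_left.congr_left fun ω => (hcast ω).symm).of_norm_left).const_mul_left c₁
  have h3 : (fun ω : ℝ => c₂ * ω ^ 2) =o[atTop] fun ω : ℝ => ω ^ 2 :=
    ((h1.sub h0).sub h2).congr_left fun ω => by ring
  by_contra hc
  have hpos : 0 < ‖c₂‖ := norm_pos_iff.2 hc
  obtain ⟨ω, hω, hω0⟩ :=
    (((Asymptotics.isLittleO_iff.1 h3) (half_pos hpos)).and (eventually_gt_atTop 0)).exists
  rw [norm_mul, norm_pow, hcast, norm_pow] at hω
  have : 0 < ‖ω‖ ^ 2 := by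
    have := norm_pos_iff.2 hω0.ne'
    positivity
  nlinarith

theorem ContDiffAt.complex_ofReal {E : Type*} [NormedAddCommGroup E] [NormedSpace ℝ E]
    {f : E → ℝ} {x : E} {n : WithTop ℕ∞} (hf : ContDiffAt ℝ n f x) :
    ContDiffAt ℝ n (fun y => (f y : ℂ)) x :=
  Complex.ofRealCLM.contDiff.contDiffAt.comp x hf

theorem ContDiffAt.partialDeriv {m : ℕ} {F : Type*} [NormedAddCommGroup F] [NormedSpace ℝ F]
    {f : (Fin m → ℝ) → F} {x : Fin m → ℝ} (hf : ContDiffAt ℝ 2 f x) (i : Fin m) :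
    ContDiffAt ℝ 1 (fun y => partialDeriv i f y) x :=
  (hf.fderiv_right (m := 1) (by norm_num)).clm_apply contDiffAt_const

theorem Filter.EventuallyEq.partialDeriv_eq {m : ℕ} {F : Type*} [NormedAddCommGroup F]
    [NormedSpace ℝ F] {f g : (Fin m → ℝ) → F} {x : Fin m → ℝ} (h : f =ᶠ[𝓝 x] g) (i : Fin m) :
    partialDeriv i f x = partialDeriv i g x := by
  rw [partialDeriv, partialDeriv, h.fderiv_eq]

/-- The rapidly oscillating factor of a wave. -/
noncomputable def phaseFactor (S : Event → ℝ) (ω : ℝ) (x : Event) : ℂ :=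
  Complex.exp (Complex.I * ω * S x)

theorem norm_phaseFactor (S : Event → ℝ) (ω : ℝ) (x : Event) : ‖phaseFactor S ω x‖ = 1 := by
  rw [phaseFactor, show Complex.I * ω * S x = ((ω * S x : ℝ) : ℂ) * Complex.I by push_cast; ring]
  exact Complex.norm_exp_ofReal_mul_I _

theorem partialDeriv_mul_phaseFactor {S : Event → ℝ} {p : Event → ℂ} {x : Event}
    (hS : DifferentiableAt ℝ S x) (hp : DifferentiableAt ℝ p x) (ω : ℝ) (μ : Fin 4) :
    partialDeriv μ (fun y => p y * phaseFactor S ω y) x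
      = (partialDeriv μ p x + Complex.I * ω * partialDeriv μ S x * p x) * phaseFactor S ω x := by
  have h1 : HasFDerivAt (fun y => (S y : ℂ)) (Complex.ofRealCLM.comp (fderiv ℝ S x)) x :=
    Complex.ofRealCLM.hasFDerivAt.comp x hS.hasFDerivAt
  have h2 := (h1.const_mul (Complex.I * ω)).cexp
  have h3 := (hp.hasFDerivAt.mul h2).fderiv
  have h4 : (fun y => p y * phaseFactor S ω y)
      = p * fun y => Complex.exp (Complex.I * ω * S y) := rfl
  rw [partialDeriv, h4, h3]
  simp [partialDeriv, phaseFactor]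
  ring

theorem partialDeriv_add_const_mul {f g : Event → ℂ} {x : Event} (hf : DifferentiableAt ℝ f x)
    (hg : DifferentiableAt ℝ g x) (c : ℂ) (μ : Fin 4) :
    partialDeriv μ (fun y => f y + c * g y) x = partialDeriv μ f x + c * partialDeriv μ g x := by
  have := (hf.hasFDerivAt.add (hg.hasFDerivAt.const_mul c)).fderiv
  have h4 : (fun y => f y + c * g y) = f + fun y => c * g y := rfl
  rw [partialDeriv, h4, this]
  simp [partialDeriv]

namespace OpticalSpacetime

variable (M : OpticalSpacetime)

theorem divTensor_congr {B C : Event → Fin 4 → Fin 4 → ℂ} {x : Event} (h : B =ᶠ[𝓝 x] C)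
    (ν : Fin 4) : M.divTensor B ν x = M.divTensor C ν x := by
  have h' : ∀ μ, (fun y => B y μ ν) =ᶠ[𝓝 x] fun y => C y μ ν := fun μ => h.fun_comp (· μ ν)
  simp only [divTensor, fun μ => (h' μ).partialDeriv_eq μ, h.eq_of_nhds]

theorem div_mul_phaseFactor {S : Event → ℝ} {V : Event → Fin 4 → ℂ} {x : Event}
    (hS : DifferentiableAt ℝ S x) (hV : ∀ μ, DifferentiableAt ℝ (fun y => V y μ) x) (ω : ℝ) :
    M.div (fun y μ => V y μ * phaseFactor S ω y) x
      = (M.div V x + Complex.I * (∑ μ, (waveCovector S x μ : ℂ) * V x μ) * ω)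
        * phaseFactor S ω x := by
  simp only [div, partialDeriv_mul_phaseFactor hS (hV _), add_mul, Finset.sum_mul, Finset.mul_sum,
    ← Finset.sum_add_distrib, waveCovector]
  refine Finset.sum_congr rfl fun μ _ => ?_
  simp only [← mul_assoc]
  ring

/-- The field of a wave has the form `(B + iωC) e^{iωS}`; one more derivative of the exponential
yields the ω² term, through `C` alone. -/
theorem divTensor_mul_phaseFactor {S : Event → ℝ} {B C : Event → Fin 4 → Fin 4 → ℂ} {x : Event}
    (hS : DifferentiableAt ℝ S x) (hB : ∀ μ ν, DifferentiableAt ℝ (fun y => B y μ ν) x)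
    (hC : ∀ μ ν, DifferentiableAt ℝ (fun y => C y μ ν) x) (ω : ℝ) (ν : Fin 4) :
    M.divTensor (fun y μ ν => (B y μ ν + Complex.I * ω * C y μ ν) * phaseFactor S ω y) ν x
      = (M.divTensor B ν x + Complex.I * (M.divTensor C ν x
          + ∑ μ, (waveCovector S x μ : ℂ) * B x μ ν) * ω
          + (-∑ μ, (waveCovector S x μ : ℂ) * C x μ ν) * ω ^ 2) * phaseFactor S ω x := by
  have hd : ∀ μ ν, DifferentiableAt ℝ (fun y => B y μ ν + Complex.I * ω * C y μ ν) x :=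
    fun μ ν => (hB μ ν).add ((hC μ ν).const_mul _)
  simp only [divTensor, partialDeriv_mul_phaseFactor hS (hd _ _),
    partialDeriv_add_const_mul (hB _ _) (hC _ _), waveCovector]
  have hin : ∀ (Γ p q : Fin 4 → ℂ) (E : ℂ),
      ∑ ρ, Γ ρ * ((p ρ + Complex.I * ω * q ρ) * E)
        = (∑ ρ, Γ ρ * p ρ + Complex.I * ω * ∑ ρ, Γ ρ * q ρ) * E := by
    intro Γ p q E
    simp only [Finset.mul_sum, Finset.sum_mul, ← Finset.sum_add_distrib]
    exact Finset.sum_congr rfl fun ρ _ => by ring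
  simp only [hin]
  simp only [← Finset.sum_add_distrib, ← Finset.sum_neg_distrib, Finset.mul_sum Finset.univ
    (fun μ => partialDeriv μ (fun y => C y μ ν) x + _ + _ + _), Finset.sum_mul Finset.univ]
  refine Finset.sum_congr rfl fun μ _ => ?_
  linear_combination (ω ^ 2 * (partialDeriv μ S x : ℝ) * C x μ ν * phaseFactor S ω x) * Complex.I_mul_I

theorem faraday_wavePotential {S : Event → ℝ} {a : Event → Fin 4 → ℂ} {x : Event}
    (hS : DifferentiableAt ℝ S x) (ha : ∀ μ, DifferentiableAt ℝ (fun y => a y μ) x) (ω : ℝ)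
    (μ ν : Fin 4) :
    faraday (wavePotential S a ω) x μ ν = (faraday a x μ ν + Complex.I * ω *
      (waveCovector S x μ * a x ν - waveCovector S x ν * a x μ)) * phaseFactor S ω x := by
  have h : ∀ μ, (fun y => wavePotential S a ω y μ) = fun y => a y μ * phaseFactor S ω y :=
    fun μ => rfl
  simp only [faraday, h, partialDeriv_mul_phaseFactor hS (ha _), waveCovector]
  ring

theorem faradayUp_wavePotential {S : Event → ℝ} {a : Event → Fin 4 → ℂ} {x : Event}
    (hS : DifferentiableAt ℝ S x) (ha : ∀ μ, DifferentiableAt ℝ (fun y => a y μ) x) (ω : ℝ)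
    (μ ν : Fin 4) :
    M.faradayUp (wavePotential S a ω) x μ ν = (M.faradayUp a x μ ν + Complex.I * ω *
      ∑ α, ∑ β, (M.gBar x μ α : ℂ) * (M.gBar x ν β : ℂ) *
        (waveCovector S x α * a x β - waveCovector S x β * a x α)) * phaseFactor S ω x := by
  simp only [faradayUp, faraday_wavePotential hS ha, Finset.mul_sum, Finset.sum_mul,
    ← Finset.sum_add_distrib]
  exact Finset.sum_congr rfl fun α _ => Finset.sum_congr rfl fun β _ => by ring

theorem contDiffAt_gBar {x : Event} (hx : x ∈ M.region) (μ ν : Fin 4) :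
    ContDiffAt ℝ 2 (fun y => M.gBar y μ ν) x :=
  (M.contDiffOn_gBar μ ν).contDiffAt (M.isOpen_region.mem_nhds hx)

namespace IsGeometricalOpticsWave

variable {M} {N : Set Event} {S : Event → ℝ} {a : Event → Fin 4 → ℂ} {x : Event}

theorem contDiffAt_phase (h : M.IsGeometricalOpticsWave N S a) (hx : x ∈ N) :
    ContDiffAt ℝ 2 S x :=
  h.phase_contDiff.contDiffAt (h.isOpen.mem_nhds hx)

theorem contDiffAt_amplitude (h : M.IsGeometricalOpticsWave N S a) (hx : x ∈ N) (μ : Fin 4) :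
    ContDiffAt ℝ 2 (fun y => a y μ) x :=
  (h.amplitude_contDiff μ).contDiffAt (h.isOpen.mem_nhds hx)

/-- The amplitude is transverse. -/
theorem transverse (h : M.IsGeometricalOpticsWave N S a) (hx : x ∈ N) :
    ∑ μ, (waveCovector S x μ : ℂ) * ∑ ν, (M.gBar x μ ν : ℂ) * a x ν = 0 := by
  have hxr := h.subset_region hx
  have hV : ∀ μ, DifferentiableAt ℝ (fun y => ∑ ν, (M.gBar y μ ν : ℂ) * a y ν) x := fun μ =>
    (ContDiffAt.sum fun ν _ => (M.contDiffAt_gBar hxr μ ν).complex_ofReal.mul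
      (h.contDiffAt_amplitude hx ν)).differentiableAt (by norm_num)
  have hdiv := fun ω : ℝ => M.div_mul_phaseFactor
    ((h.contDiffAt_phase hx).differentiableAt (by norm_num)) hV ω
  -- The gauge condition is multiplied by `ω` to fit the quadratic criterion, with constant term
  -- `0`.
  have hL : (fun ω : ℝ => (0 + M.div (fun y μ => ∑ ν, (M.gBar y μ ν : ℂ) * a y ν) x * ω
      + (Complex.I * ∑ μ, (waveCovector S x μ : ℂ) * ∑ ν, (M.gBar x μ ν : ℂ) * a x ν) * ω ^ 2)
      * phaseFactor S ω x) =o[atTop] fun ω : ℝ => ω ^ 2 := by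
    have h1 : (fun ω : ℝ => (ω : ℂ)) =O[atTop] fun ω : ℝ => ω :=
      Asymptotics.isBigO_of_le _ fun ω => by simp
    refine (h1.mul_isLittleO (h.lorenz_eq x hx)).congr (fun ω => ?_) fun ω => (sq ω).symm
    rw [lorenz, zero_add, show M.div _ x = _ from (congrArg (M.div · x) ?_).trans (hdiv ω)]
    · ring
    · funext y μ
      rw [Finset.sum_mul]
      exact Finset.sum_congr rfl fun ν _ => (mul_assoc _ _ _).symm
  have := eq_zero_of_quadratic_isLittleO (fun ω => norm_phaseFactor S ω x) hL
  exact (mul_eq_zero.1 this).resolve_left Complex.I_ne_zero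

/-- The dispersion relation `ḡ^{μν} k_μ k_ν = 0`. -/
theorem hamiltonian_eq_zero (h : M.IsGeometricalOpticsWave N S a) (hx : x ∈ N) :
    M.hamiltonian (x, waveCovector S x) = 0 := by
  have hxr := h.subset_region hx
  have hS : ∀ y ∈ N, DifferentiableAt ℝ S y := fun y hy =>
    (h.contDiffAt_phase hy).differentiableAt (by norm_num)
  have ha : ∀ y ∈ N, ∀ μ, DifferentiableAt ℝ (fun y => a y μ) y := fun y hy μ =>
    (h.contDiffAt_amplitude hy μ).differentiableAt (by norm_num)
  set r : Event → ℂ := fun y => (√(M.eps y / M.mu y) : ℂ) with hr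
  set B : Event → Fin 4 → Fin 4 → ℂ := fun y μ ν => r y * M.faradayUp a y μ ν
  set C : Event → Fin 4 → Fin 4 → ℂ := fun y μ ν => r y *
    ∑ α, ∑ β, (M.gBar y μ α : ℂ) * (M.gBar y ν β : ℂ) *
        (waveCovector S y α * a y β - waveCovector S y β * a y α) with hC
  have hratio : 0 < M.eps x / M.mu x := div_pos (M.eps_pos x hxr) (M.mu_pos x hxr)
  have hg : ∀ μ ν, ContDiffAt ℝ 1 (fun y => (M.gBar y μ ν : ℂ)) x := fun μ ν =>
    (M.contDiffAt_gBar hxr μ ν).complex_ofReal.of_le (by norm_num)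
  have hrd : ContDiffAt ℝ 1 r x := by
    have hn := M.isOpen_region.mem_nhds hxr
    exact ((((M.eps_contDiff.contDiffAt hn).div (M.mu_contDiff.contDiffAt hn)
      (M.mu_pos x hxr).ne').sqrt hratio.ne').complex_ofReal).of_le (by norm_num)
  have hB : ∀ μ ν, DifferentiableAt ℝ (fun y => B y μ ν) x := fun μ ν =>
    (hrd.mul (ContDiffAt.sum fun α _ => ContDiffAt.sum fun β _ => ((hg μ α).mul (hg ν β)).mul
      (((h.contDiffAt_amplitude hx β).partialDeriv α).sub
        ((h.contDiffAt_amplitude hx α).partialDeriv β)))).differentiableAt (by norm_num)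
  have hk : ∀ μ, ContDiffAt ℝ 1 (fun y => (waveCovector S y μ : ℂ)) x := fun μ =>
    ((h.contDiffAt_phase hx).partialDeriv μ).complex_ofReal
  have ha1 : ∀ μ, ContDiffAt ℝ 1 (fun y => a y μ) x := fun μ =>
    (h.contDiffAt_amplitude hx μ).of_le (by norm_num)
  have hCd : ∀ μ ν, DifferentiableAt ℝ (fun y => C y μ ν) x := fun μ ν =>
    (hrd.mul (ContDiffAt.sum fun α _ => ContDiffAt.sum fun β _ => ((hg μ α).mul (hg ν β)).mul
      (((hk α).mul (ha1 β)).sub ((hk β).mul (ha1 α))))).differentiableAt (by norm_num)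
  have hmax : ∀ ν, ∑ μ, (waveCovector S x μ : ℂ) * C x μ ν = 0 := by
    intro ν
    have hM := h.maxwell_eq x hx ν
    have hexp : ∀ ω : ℝ, M.maxwell (wavePotential S a ω) ν x = _ := fun ω =>
      (M.divTensor_congr (eventually_of_mem (h.isOpen.mem_nhds hx) fun y hy => by
        funext μ ν
        simp only [faradayUp_wavePotential M (hS y hy) (ha y hy), B, C, hr]
        ring) ν).trans (M.divTensor_mul_phaseFactor (hS x hx) hB hCd ω ν)
    simp only [hexp] at hM
    exact neg_eq_zero.1
      (eq_zero_of_quadratic_isLittleO (fun ω => norm_phaseFactor S ω x) hM)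
  have hr0 : r x ≠ 0 := Complex.ofReal_ne_zero.2 (Real.sqrt_pos.2 hratio).ne'
  have htr := h.transverse hx
  -- Contracting gives `k_μ C^{μν} = r (k² a^ν - k^ν (k · a))`, and transversality removes the
  -- second term. Since the raised amplitude is nonzero, `k² = 0`.
  have hred : ∀ ν, (2 * M.hamiltonian (x, waveCovector S x) : ℂ)
      * ∑ β, (M.gBar x ν β : ℂ) * a x β = 0 := by
    intro ν
    have h1 : ∑ μ, (waveCovector S x μ : ℂ) * C x μ ν
        = r x * ((2 * M.hamiltonian (x, waveCovector S x) : ℂ) * (∑ β, (M.gBar x ν β : ℂ) * a x β)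
          - (∑ β, (M.gBar x ν β : ℂ) * waveCovector S x β) *
            ∑ μ, (waveCovector S x μ : ℂ) * ∑ ν, (M.gBar x μ ν : ℂ) * a x ν) := by
      simp only [hC, hamiltonian, Fin.sum_univ_four]
      push_cast
      ring
    rw [htr, mul_zero, sub_zero, hmax ν] at h1
    exact (mul_eq_zero.1 h1.symm).resolve_left hr0
  by_contra hne
  refine h.amplitude_ne_zero x hx (M.eq_zero_of_gBar_sum_eq_zero hxr fun ν => ?_)
  exact (mul_eq_zero.1 (hred ν)).resolve_left
    (mul_ne_zero two_ne_zero (Complex.ofReal_ne_zero.2 hne))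

end IsGeometricalOpticsWave

end OpticalSpacetime

/-! ### Lift of light rays to null Hamilton paths, and coordinates on level sets. -/

/-- The derivative of the wave covector is the Hessian of the phase. -/
theorem hasFDerivAt_waveCovector {S : Event → ℝ} {x : Event} (hS : ContDiffAt ℝ 2 S x) :
    HasFDerivAt (OpticalSpacetime.waveCovector S)
      (ContinuousLinearMap.pi fun μ => (fderiv ℝ (fderiv ℝ S) x).flip (Pi.single μ 1)) x := by
  have hd : HasFDerivAt (fderiv ℝ S) (fderiv ℝ (fderiv ℝ S) x) x :=
    ((hS.fderiv_right (m := 1) (by norm_num)).differentiableAt (by norm_num)).hasFDerivAt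
  refine hasFDerivAt_pi.2 fun μ => ?_
  refine (hd.clm_apply (hasFDerivAt_const (Pi.single μ (1 : ℝ) : Event) x)).congr_fderiv ?_
  ext1 v
  simp

/-- A quantitative substitute for the implicit function theorem: on the level set `D (k' - k)` is of
higher order, so the `j`-th component is controlled by the others. -/
theorem norm_sub_le_of_level {n : ℕ} {f : (Fin (n + 1) → ℝ) → ℝ} {k : Fin (n + 1) → ℝ}
    (hf : DifferentiableAt ℝ f k) {j : Fin (n + 1)} (hj : fderiv ℝ f k (Pi.single j 1) ≠ 0) :
    ∃ C, ∃ δ > 0, ∀ k', f k' = f k → ‖k' - k‖ < δ →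
      ‖k' - k‖ ≤ C * ‖j.removeNth k' - j.removeNth k‖ := by
  set D := fderiv ℝ f k
  set b := |D (Pi.single j 1)|
  have hb : 0 < b := abs_pos.2 hj
  obtain ⟨δ, hδ, hlo⟩ := Metric.eventually_nhds_iff.1
    (Asymptotics.isLittleO_iff.1 hf.hasFDerivAt.isLittleO (half_pos hb))
  -- The estimates below combine to `b ‖d‖ ≤ (b / 2) ‖d‖ + (‖D‖ + b) q`; half of the left side
  -- absorbs the first term.
  refine ⟨2 * (‖D‖ + b) / b, δ, hδ, fun k' hk' hd => ?_⟩
  have h1 := hlo (by rwa [dist_eq_norm])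
  set d := k' - k
  have hR : j.removeNth k' - j.removeNth k = j.removeNth d := rfl
  rw [hR]
  set q := ‖j.removeNth d‖
  rw [hk', sub_self, zero_sub, norm_neg, Real.norm_eq_abs] at h1
  have h2 : ‖d - d j • (Pi.single j 1 : Fin (n + 1) → ℝ)‖ ≤ q := by
    refine (pi_norm_le_iff_of_nonneg (norm_nonneg _)).2 fun i => ?_
    rcases Fin.eq_self_or_eq_succAbove j i with rfl | ⟨i, rfl⟩
    · simp
    · have := norm_le_pi_norm (j.removeNth d) i
      simp only [Fin.removeNth_apply] at this
      simpa using this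
  have h3 : ‖d‖ ≤ |d j| + q := by
    refine (pi_norm_le_iff_of_nonneg (by positivity)).2 fun i => ?_
    rcases Fin.eq_self_or_eq_succAbove j i with rfl | ⟨i, rfl⟩
    · simp [q]
    · have := norm_le_pi_norm (j.removeNth d) i
      have h0 := abs_nonneg (d j)
      simp only [Fin.removeNth_apply] at this
      linarith
  have h4 : |d j| * b ≤ |D d| + ‖D‖ * q := by
    have : d j * D (Pi.single j 1) = D d - D (d - d j • Pi.single j 1) := by
      simp
    rw [← abs_mul, this]
    refine (abs_sub _ _).trans (add_le_add_right ?_ _)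
    exact (D.le_opNorm _).trans (by gcongr)
  rw [div_mul_eq_mul_div, le_div_iff₀ hb]
  nlinarith

theorem mkEvent_sub_mkEvent_succ (s t : ℝ) (x y : Position) (i : Fin 3) :
    mkEvent s x i.succ - mkEvent t y i.succ = x i - y i := by
  simp [mkEvent]

theorem norm_sub_le_norm_mkEvent_sub (s t : ℝ) (x y : Position) :
    ‖x - y‖ ≤ ‖mkEvent s x - mkEvent t y‖ := by
  refine (pi_norm_le_iff_of_nonneg (norm_nonneg _)).2 fun i => ?_
  have := norm_le_pi_norm (mkEvent s x - mkEvent t y) i.succ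
  rwa [Pi.sub_apply, mkEvent_sub_mkEvent_succ] at this

namespace OpticalSpacetime

variable {M : OpticalSpacetime}

theorem gBarLow_mulVec_gBar {x : Event} (hx : x ∈ M.region) (p : Event) :
    (M.gBarLow x).mulVec (fun μ => ∑ ν, M.gBar x μ ν * p ν) = p := by
  have : (fun μ => ∑ ν, M.gBar x μ ν * p ν) = (M.gBar x).mulVec p := rfl
  rw [this, Matrix.mulVec_mulVec, M.gBarLow_mul_gBar hx, Matrix.one_mulVec]

/-- The Hamilton equation for the momentum, along the gradient of the phase of a wave. -/
theorem IsGeometricalOpticsWave.fderiv_waveCovector {N : Set Event} {S : Event → ℝ}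
    {a : Event → Fin 4 → ℂ} {x : Event} (h : M.IsGeometricalOpticsWave N S a) (hx : x ∈ N) :
    (ContinuousLinearMap.pi fun μ => (fderiv ℝ (fderiv ℝ S) x).flip (Pi.single μ 1))
        (M.waveVector S x)
      = (hamiltonVector (fderiv ℝ M.hamiltonian (x, waveCovector S x))).2 := by
  have hxr := h.subset_region hx
  have hS := h.contDiffAt_phase hx
  set W : Event →L[ℝ] (Fin 4 → ℝ) :=
    ContinuousLinearMap.pi fun μ => (fderiv ℝ (fderiv ℝ S) x).flip (Pi.single μ 1)
  have hsymm : IsSymmSndFDerivAt ℝ S x := hS.isSymmSndFDerivAt (by simp)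
  -- The dispersion relation holds on all of `N`, so it may be differentiated along the graph of
  -- `dS`. Symmetry of the Hessian then turns the result into the momentum equation.
  have hzero : ∀ v, fderiv ℝ M.hamiltonian (x, waveCovector S x) (v, W v) = 0 := by
    have h1 : HasFDerivAt (fun y => M.hamiltonian (y, waveCovector S y))
        ((fderiv ℝ M.hamiltonian (x, waveCovector S x)).comp
          ((ContinuousLinearMap.id ℝ Event).prod W)) x :=
      HasFDerivAt.comp (g := M.hamiltonian) (f := fun y => (y, waveCovector S y)) x
        (M.differentiableAt_hamiltonian hxr).hasFDerivAt
        ((hasFDerivAt_id x).prodMk (hasFDerivAt_waveCovector hS))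
    have h2 : HasFDerivAt (fun y => M.hamiltonian (y, waveCovector S y))
        (0 : Event →L[ℝ] ℝ) x :=
      (hasFDerivAt_const (0 : ℝ) x).congr_of_eventuallyEq
        (eventually_of_mem (h.isOpen.mem_nhds hx) fun y hy => h.hamiltonian_eq_zero hy)
    intro v
    exact DFunLike.congr_fun (h1.unique h2) v
  funext μ
  have h3 := hzero (Pi.single μ 1)
  have h4 : ((Pi.single μ 1 : Event), W (Pi.single μ 1))
      = (Pi.single μ 1, 0) + (0, W (Pi.single μ 1)) := by simp
  rw [h4, map_add, M.fderiv_hamiltonian_snd hxr] at h3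
  have h5 : W (M.waveVector S x) μ
      = ∑ ν, W (Pi.single μ 1) ν * M.waveVector S x ν := by
    have hv : M.waveVector S x = ∑ ν, M.waveVector S x ν • (Pi.single ν 1 : Event) := by
      ext i
      simp [Finset.sum_apply, Pi.single_apply]
    conv_lhs => rw [hv, map_sum, Finset.sum_apply]
    refine Finset.sum_congr rfl fun ν _ => ?_
    simp only [map_smul, Pi.smul_apply, smul_eq_mul, W, ContinuousLinearMap.coe_pi',
      ContinuousLinearMap.flip_apply]
    rw [hsymm.eq (Pi.single ν 1) (Pi.single μ 1)]
    ring
  rw [h5]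
  simp only [waveVector, hamiltonVector]
  linarith

/-- A light ray lifts to a null solution of the Hamilton equations, with nonzero momentum. -/
theorem IsLightRay.exists_isNullHamiltonPath {Γ : ℝ → Event} (h : M.IsLightRay Γ) :
    ∃ z : ℝ → Event × Event, IsNullHamiltonPath M.hamiltonian M.phaseSpace z ∧
      (∀ s, (z s).1 = Γ s) ∧ ∀ s ∈ Icc (0 : ℝ) 1, (z s).2 ≠ 0 := by
  -- Lowering the index of the velocity defines the momentum globally, independently of the local
  -- waves; near each parameter it equals the covector of the wave given there.
  set z : ℝ → Event × Event := fun r =>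
    (Γ r, (M.gBarLow (Γ r)).mulVec (derivWithin Γ (Icc 0 1) r))
  have key : ∀ s ∈ Icc (0 : ℝ) 1, ((z s).1 ∈ M.region ∧ M.hamiltonian (z s) = 0 ∧
      HasDerivWithinAt z (hamiltonVector (fderiv ℝ M.hamiltonian (z s))) (Icc 0 1) s) ∧
      (z s).2 ≠ 0 := by
    intro s hs
    obtain ⟨N, S, a, hsN, hw, hfut, hder⟩ := h s hs
    have hΓ : HasDerivWithinAt Γ (M.waveVector S (Γ s)) (Icc 0 1) s := hder.self_of_nhdsWithin hs
    have hz : ∀ᶠ r in 𝓝[Icc 0 1] s, z r = (Γ r, waveCovector S (Γ r)) := by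
      filter_upwards [hder, self_mem_nhdsWithin,
        hΓ.continuousWithinAt (hw.isOpen.mem_nhds hsN)] with r hr hr01 hrN
      simp only [z]
      rw [hr.derivWithin (uniqueDiffOn_Icc zero_lt_one r hr01)]
      exact congrArg _ (gBarLow_mulVec_gBar (hw.subset_region hrN) _)
    have hzs := hz.self_of_nhdsWithin hs
    have hreg := hw.subset_region hsN
    rw [hzs]
    refine ⟨⟨hreg, hw.hamiltonian_eq_zero hsN, ?_⟩, ?_⟩
    · refine HasDerivWithinAt.congr_of_eventuallyEq ?_ hz hzs
      have h1 := (hasFDerivAt_waveCovector (hw.contDiffAt_phase hsN)).comp_hasDerivWithinAt s hΓ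
      rw [hw.fderiv_waveCovector hsN] at h1
      refine (hΓ.prodMk h1).congr_deriv (Prod.ext ?_ rfl)
      exact (M.hamiltonVector_hamiltonian_fst hreg _).symm
    · intro h0
      simp only at h0
      simp [h0] at hfut
  exact ⟨z, fun s hs => ⟨⟨(key s hs).1.1, mem_univ _⟩, (key s hs).1.2⟩, fun s => rfl,
    fun s hs => (key s hs).2⟩

/-- The reversal of momenta. -/
def reverseMomentum : Event × Event →L[ℝ] Event × Event :=
  (ContinuousLinearMap.fst ℝ Event Event).prod (-ContinuousLinearMap.snd ℝ Event Event)

theorem hamiltonian_reverseMomentum (z : Event × Event) :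
    M.hamiltonian (reverseMomentum z) = M.hamiltonian z := by
  simp [hamiltonian, reverseMomentum]

/-- The Hamiltonian is even in the momenta, so reversing them together with the parameter preserves
the Hamilton equations. Rays with a common reception event thereby start at it. -/
theorem isNullHamiltonPath_reverse {z : ℝ → Event × Event}
    (hz : IsNullHamiltonPath M.hamiltonian M.phaseSpace z) :
    IsNullHamiltonPath M.hamiltonian M.phaseSpace fun s => reverseMomentum (z (1 - s)) := by
  intro s hs
  have hs' : 1 - s ∈ Icc (0 : ℝ) 1 := ⟨by linarith [hs.2], by linarith [hs.1]⟩
  obtain ⟨h1, h2, h3⟩ := hz _ hs'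
  refine ⟨⟨h1.1, mem_univ _⟩, (hamiltonian_reverseMomentum _).trans h2, ?_⟩
  have h4 : (fderiv ℝ M.hamiltonian (reverseMomentum (z (1 - s)))).comp reverseMomentum
      = fderiv ℝ M.hamiltonian (z (1 - s)) := by
    have hd : DifferentiableAt ℝ M.hamiltonian (reverseMomentum (z (1 - s))) :=
      M.differentiableAt_hamiltonian h1.1
    have := (hd.hasFDerivAt.comp (z (1 - s)) reverseMomentum.hasFDerivAt).fderiv
    rw [← this]
    exact congrArg (fderiv ℝ · _) (funext hamiltonian_reverseMomentum)
  have h5 : HasDerivWithinAt (fun s : ℝ => 1 - s) (-1) (Icc 0 1) s :=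
    ((hasDerivAt_id s).const_sub 1).hasDerivWithinAt
  have h6 := h3.scomp s h5 fun r hr => ⟨by linarith [hr.2], by linarith [hr.1]⟩
  refine (reverseMomentum.hasFDerivAt.comp_hasDerivWithinAt s h6).congr_deriv ?_
  rw [← h4]
  ext i
  · simp [hamiltonVector, reverseMomentum, ← map_neg]
  · simp [hamiltonVector, reverseMomentum]

end OpticalSpacetime

/-! ### Graphs reached by null paths are null. -/

/-- The conormal `(1, -∂_i u)` of the hypersurface `x⁰ = u(𝐱)`. -/
noncomputable def graphConormal (u : Position → ℝ) (x : Position) : Event :=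
  Fin.cons 1 fun i => -partialDeriv i u x

namespace OpticalSpacetime

variable {M : OpticalSpacetime}

theorem hamiltonian_smul (x p : Event) (t : ℝ) :
    M.hamiltonian (x, t • p) = t ^ 2 * M.hamiltonian (x, p) := by
  simp only [hamiltonian, Finset.mul_sum, Pi.smul_apply, smul_eq_mul]
  exact Finset.sum_congr rfl fun μ _ => Finset.sum_congr rfl fun ν _ => by ring

theorem continuousAt_hamiltonian_graph {u : Position → ℝ} {x₀ : Position}
    (hu : ContDiffAt ℝ 1 u x₀) (hx₀ : mkEvent (u x₀) x₀ ∈ M.region) :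
    ContinuousAt (fun x => M.hamiltonian (mkEvent (u x) x, graphConormal u x)) x₀ := by
  have h1 : ContinuousAt (fun x => mkEvent (u x) x) x₀ := by
    refine continuousAt_pi.2 (Fin.cases ?_ fun i => ?_)
    · exact hu.continuousAt
    · exact (continuous_apply i).continuousAt
  have h2 : ContinuousAt (fun x => graphConormal u x) x₀ := by
    refine continuousAt_pi.2 (Fin.cases ?_ fun i => ?_)
    · exact continuousAt_const
    · have := (hu.fderiv_right (m := 0) (by norm_num)).continuousAt
      exact (this.clm_apply (continuousAt_const (y := (Pi.single i 1 : Position)))).neg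
  exact ContinuousAt.comp (g := M.hamiltonian) (f := fun x => (mkEvent (u x) x, graphConormal u x))
    (M.differentiableAt_hamiltonian (z := (mkEvent (u x₀) x₀, graphConormal u x₀))
      hx₀).continuousAt (h1.prodMk h2)

theorem exists_gBar_sum_ne_zero {x : Event} (hx : x ∈ M.region) {p : Event} (hp : p ≠ 0) :
    ∃ j, ∑ ν, M.gBar x j ν * p ν ≠ 0 := by
  by_contra! h
  apply hp
  rw [← gBarLow_mulVec_gBar hx p, show (fun μ => ∑ ν, M.gBar x μ ν * p ν) = 0 from funext h,
    Matrix.mulVec_zero]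

/-- On the null cone of momenta at an event, all but one of the components are coordinates. -/
theorem norm_sub_le_of_null {x p : Event} (hx : x ∈ M.region) {j : Fin 4}
    (hj : ∑ ν, M.gBar x j ν * p ν ≠ 0) (hp : M.hamiltonian (x, p) = 0) :
    ∃ C, ∃ δ > 0, ∀ p', M.hamiltonian (x, p') = 0 → ‖p' - p‖ < δ →
      ‖p' - p‖ ≤ C * ‖j.removeNth p' - j.removeNth p‖ := by
  have hd : HasFDerivAt (fun q => M.hamiltonian (x, q))
      ((fderiv ℝ M.hamiltonian (x, p)).comp (ContinuousLinearMap.inr ℝ Event Event)) p :=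
    (M.differentiableAt_hamiltonian (z := (x, p)) hx).hasFDerivAt.comp p
      (hasFDerivAt_prodMk_right x p)
  obtain ⟨C, δ, hδ, h⟩ := norm_sub_le_of_level hd.differentiableAt (j := j) (by
    rw [hd.fderiv]
    refine ne_of_eq_of_ne (M.fderiv_hamiltonian_snd hx p _) ?_
    simpa [Pi.single_apply] using hj)
  exact ⟨C, δ, hδ, fun p' hp' => h p' (hp'.trans hp.symm)⟩

/-- A functional that measures how much the momentum `p` fails to be conormal to a graph. -/
noncomputable def conormalDefect (u : Position → ℝ) (x : Position) (p : Event) : Position →L[ℝ] ℝ :=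
  p 0 • fderiv ℝ u x + ∑ i : Fin 3, p i.succ • ContinuousLinearMap.proj i

/-- If it vanished, `p` would be `p 0` times the conormal; as `p` is null and the conormal is not,
`p 0` and then `p` would be zero. -/
theorem conormalDefect_ne_zero {u : Position → ℝ} {x : Position} {p : Event} (hp : p ≠ 0)
    (hnull : M.hamiltonian (mkEvent (u x) x, p) = 0)
    (hne : M.hamiltonian (mkEvent (u x) x, graphConormal u x) ≠ 0) :
    conormalDefect u x p ≠ 0 := by
  intro h0
  have h1 : p = p 0 • graphConormal u x := by
    funext μ
    refine Fin.cases ?_ (fun i => ?_) μ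
    · simp [graphConormal]
    · have := DFunLike.congr_fun h0 (Pi.single i 1)
      simp [conormalDefect, Pi.single_apply] at this
      simp [graphConormal, partialDeriv]
      linarith
  rw [h1, hamiltonian_smul] at hnull
  have h2 : p 0 = 0 := pow_eq_zero_iff two_ne_zero |>.1 ((mul_eq_zero.1 hnull).resolve_right hne)
  exact hp (by rw [h1, h2, zero_smul])

/-- The first term is quadratic by the endpoint variation, and the second is a Taylor remainder of
`u`. -/
theorem conormalDefect_sub (u : Position → ℝ) (x x' : Position) (p : Event) :
    conormalDefect u x p (x' - x) = ∑ μ, p μ * (mkEvent (u x') x' μ - mkEvent (u x) x μ)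
      - p 0 * (u x' - u x - fderiv ℝ u x (x' - x)) := by
  rw [Fin.sum_univ_succ]
  simp [conormalDefect, mkEvent]
  ring

/-- If all the events of a `C¹` graph `x⁰ = u(𝐱)` over a neighbourhood of `x₀` are joined to one
event by null solutions of the Hamilton equations, then the graph is null over `x₀`. -/
theorem hamiltonian_graphConormal_eq_zero {P : Event} {u : Position → ℝ} {x₀ : Position}
    (hu : ContDiffAt ℝ 1 u x₀)
    (hr : ∀ᶠ x in 𝓝 x₀, ∃ z, IsNullHamiltonPath M.hamiltonian M.phaseSpace z ∧ (z 0).1 = P ∧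
      (z 1).1 = mkEvent (u x) x ∧ (z 0).2 ≠ 0 ∧ (z 1).2 ≠ 0) :
    M.hamiltonian (mkEvent (u x₀) x₀, graphConormal u x₀) = 0 := by
  have hzero : (0 : ℝ) ∈ Icc (0 : ℝ) 1 := ⟨le_rfl, zero_le_one⟩
  have hone : (1 : ℝ) ∈ Icc (0 : ℝ) 1 := ⟨zero_le_one, le_rfl⟩
  obtain ⟨hP, hx₀⟩ : P ∈ M.region ∧ mkEvent (u x₀) x₀ ∈ M.region := by
    obtain ⟨z, hz, h0, h1, -⟩ := hr.self_of_nhds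
    exact ⟨h0 ▸ (hz 0 hzero).1.1, h1 ▸ (hz 1 hone).1.1⟩
  by_contra hne
  set X := {x | M.hamiltonian (mkEvent (u x) x, graphConormal u x) ≠ 0 ∧
    DifferentiableAt ℝ u x ∧ ∃ z, IsNullHamiltonPath M.hamiltonian M.phaseSpace z ∧
      (z 0).1 = P ∧ (z 1).1 = mkEvent (u x) x ∧ (z 0).2 ≠ 0 ∧ (z 1).2 ≠ 0} with hXdef
  have hX : X ∈ 𝓝 x₀ := by
    filter_upwards [(continuousAt_hamiltonian_graph hu hx₀).eventually_ne hne,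
      hu.eventually (by simp), hr] with x h1 h2 h3
    exact ⟨h1, h2.differentiableAt (by norm_num), h3⟩
  refine (MeasureTheory.Measure.measure_pos_of_mem_nhds MeasureTheory.volume hX).ne' ?_
  -- The path to each point is picked arbitrarily.
  have hch : ∀ x, ∃ z, x ∈ X → IsNullHamiltonPath M.hamiltonian M.phaseSpace z ∧
      (z 0).1 = P ∧ (z 1).1 = mkEvent (u x) x ∧ (z 0).2 ≠ 0 ∧ (z 1).2 ≠ 0 := by
    intro x
    by_cases hx : x ∈ X
    · obtain ⟨z, hz⟩ := hx.2.2
      exact ⟨z, fun _ => hz⟩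
    · exact ⟨0, fun h => absurd h hx⟩
  choose z hz using hch
  -- The null cone at `P` is a three-dimensional hypersurface; on the `j`-th piece the component `j`
  -- of the initial momentum is controlled by the other three.
  have hcover : X ⊆ ⋃ j, {x ∈ X | ∑ ν, M.gBar P j ν * (z x 0).2 ν ≠ 0} := by
    intro x hx
    obtain ⟨j, hj⟩ := exists_gBar_sum_ne_zero hP (hz x hx).2.2.2.1
    exact mem_iUnion.2 ⟨j, hx, hj⟩
  refine MeasureTheory.measure_mono_null hcover (MeasureTheory.measure_iUnion_null fun j => ?_)
  have hnull : ∀ x ∈ X, M.hamiltonian (P, (z x 0).2) = 0 := by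
    intro x hx
    rw [← (hz x hx).2.1]
    exact ((hz x hx).1 0 hzero).2.1
  have hvar : ∀ x ∈ X, ∃ C > 0, ∃ δ > 0, ∀ x' ∈ X, ‖(z x' 0).2 - (z x 0).2‖ < δ →
      ‖x' - x‖ ≤ C * ‖(z x' 0).2 - (z x 0).2‖ ∧
      |∑ μ, (z x 1).2 μ * (mkEvent (u x') x' μ - mkEvent (u x) x μ)|
        ≤ C * ‖(z x' 0).2 - (z x 0).2‖ ^ 2 := by
    intro x hx
    obtain ⟨C, δ, hδ, h⟩ := (hz x hx).1.endpoint_variation M.isOpen_phaseSpace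
      M.contDiffOn_hamiltonian
      (fun z hz h0 => by rw [M.fderiv_hamiltonian_self hz, h0, mul_zero])
    refine ⟨max C 1, by positivity, δ, hδ, fun x' hx' hd => ?_⟩
    have := h (z x') (hz x' hx').1 ((hz x' hx').2.1.trans (hz x hx).2.1.symm) hd
    rw [(hz x hx).2.2.1, (hz x' hx').2.2.1] at this
    exact ⟨(norm_sub_le_norm_mkEvent_sub _ _ _ _).trans (this.1.trans (by
      gcongr; exact le_max_left _ _)), this.2.trans (by gcongr; exact le_max_left _ _)⟩
  have hchart : ∀ x ∈ X, ∑ ν, M.gBar P j ν * (z x 0).2 ν ≠ 0 → ∃ C > 0, ∃ δ > 0, ∀ x' ∈ X,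
      ‖(z x' 0).2 - (z x 0).2‖ < δ → ‖(z x' 0).2 - (z x 0).2‖
        ≤ C * ‖j.removeNth (z x' 0).2 - j.removeNth (z x 0).2‖ := by
    intro x hx hj
    obtain ⟨C, δ, hδ, h⟩ := norm_sub_le_of_null hP hj (hnull x hx)
    exact ⟨max C 1, by positivity, δ, hδ, fun x' hx' hd =>
      (h _ (hnull x' hx') hd).trans (by gcongr; exact le_max_left _ _)⟩
  refine volume_eq_zero_of_flat (k := fun x => (z x 0).2) (κ := fun p => j.removeNth p) ?_ ?_
  · rintro x ⟨hx, hj⟩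
    obtain ⟨C₁, hC₁, δ₁, hδ₁, h₁⟩ := hvar x hx
    obtain ⟨C₂, hC₂, δ₂, hδ₂, h₂⟩ := hchart x hx hj
    refine ⟨max C₂ (C₁ * C₂), min δ₁ δ₂, lt_min hδ₁ hδ₂, fun x' hx' hd => ?_⟩
    rw [dist_eq_norm] at hd ⊢
    have b1 := (h₁ x' hx'.1 (hd.trans_le (min_le_left _ _))).1
    have b2 := h₂ x' hx'.1 (hd.trans_le (min_le_right _ _))
    refine ⟨b2.trans (by gcongr; exact le_max_left _ _), ?_⟩
    calc ‖x' - x‖ ≤ C₁ * (C₂ * ‖j.removeNth (z x' 0).2 - j.removeNth (z x 0).2‖) :=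
          b1.trans (by gcongr)
      _ = (C₁ * C₂) * ‖j.removeNth (z x' 0).2 - j.removeNth (z x 0).2‖ := by ring
      _ ≤ _ := by gcongr; exact le_max_right _ _
  · rintro x ⟨hx, hj⟩
    obtain ⟨C₁, hC₁, δ₁, hδ₁, h₁⟩ := hvar x hx
    obtain ⟨C₂, hC₂, δ₂, hδ₂, h₂⟩ := hchart x hx hj
    have hzx := hz x hx
    set p := (z x 1).2
    refine ⟨conormalDefect u x p, conormalDefect_ne_zero hzx.2.2.2.2
      (hzx.2.2.1 ▸ (hzx.1 1 hone).2.1) hx.1, fun ε hε => ?_⟩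
    -- With this `η` the Taylor remainder of `u`, multiplied by `p 0`, contributes at most `ε / 2 *
    -- q`; the `+ 1` covers `p 0 = 0`.
    set η := ε / (2 * C₁ * C₂ * (|p 0| + 1)) with hη
    have hηpos : 0 < η := by positivity
    obtain ⟨δ₃, hδ₃, h₃⟩ := Metric.eventually_nhds_iff.1
      (Asymptotics.isLittleO_iff.1 hx.2.1.hasFDerivAt.isLittleO hηpos)
    -- The bound `δ₃ / C₁` brings `x'` within the range of the Taylor estimate, and `ε / (2 * C₁ *
    -- C₂)` limits the quadratic term to the other `ε / 2 * q`.
    refine ⟨min (min δ₁ δ₂) (min (δ₃ / C₁) (ε / (2 * C₁ * C₂))), by positivity,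
      fun x' hx' hd => ?_⟩
    rw [dist_eq_norm, lt_min_iff, lt_min_iff, lt_min_iff] at hd
    obtain ⟨⟨hd₁, hd₂⟩, hd₃, hd₄⟩ := hd
    obtain ⟨b1, b1'⟩ := h₁ x' hx'.1 hd₁
    have b2 := h₂ x' hx'.1 hd₂
    set d := ‖(z x' 0).2 - (z x 0).2‖
    set q := ‖j.removeNth (z x' 0).2 - j.removeNth (z x 0).2‖
    have hd0 : 0 ≤ d := norm_nonneg _
    have b3 := h₃ (y := x') (by
      rw [dist_eq_norm]
      refine b1.trans_lt ?_
      rw [lt_div_iff₀ hC₁] at hd₃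
      linarith)
    rw [Real.norm_eq_abs] at b3
    have e1 : C₁ * d ^ 2 ≤ ε / (2 * C₂) * d := by
      have : C₁ * (ε / (2 * C₁ * C₂)) = ε / (2 * C₂) := by field_simp
      rw [← this, sq, ← mul_assoc]
      gcongr
    have e2 : |p 0| * (η * (C₁ * d)) ≤ ε / (2 * C₂) * d := by
      have : (|p 0| + 1) * (η * (C₁ * d)) = ε / (2 * C₂) * d := by
        rw [hη]
        field_simp
      rw [← this]
      gcongr
      linarith
    have e3 : ε / (2 * C₂) * d ≤ ε / 2 * q := by
      calc ε / (2 * C₂) * d ≤ ε / (2 * C₂) * (C₂ * q) := by gcongr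
        _ = ε / 2 * q := by field_simp
    rw [conormalDefect_sub]
    refine (abs_sub _ _).trans ?_
    rw [abs_mul]
    have e4 : |p 0| * |u x' - u x - fderiv ℝ u x (x' - x)| ≤ |p 0| * (η * (C₁ * d)) := by
      gcongr
      exact b3.trans (by gcongr)
    linarith

/-! ### Application to the range transfer functions. -/

theorem two_mul_hamiltonian_cons (y : Event) (hy : y ∈ M.region) (v : Position) :
    2 * M.hamiltonian (y, Fin.cons 1 v) = M.gBar y 0 0
      + 2 * ∑ i : Fin 3, M.gBar y 0 i.succ * v i
      + ∑ i : Fin 3, ∑ j : Fin 3, M.gBar y i.succ j.succ * v i * v j := by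
  simp only [hamiltonian, Fin.sum_univ_succ (n := 3), Fin.cons_zero, Fin.cons_succ,
    mul_one, Finset.sum_add_distrib, M.gBar_comm hy (Fin.succ _) 0]
  ring

theorem mkEvent_position (x : Event) : mkEvent (x 0) x.position = x :=
  Fin.cons_self_tail x

/-- The light rays received at an event. -/
theorem LightConnected.exists_path_from_reception {p q : Event} (h : M.LightConnected p q) :
    ∃ z, IsNullHamiltonPath M.hamiltonian M.phaseSpace z ∧ (z 0).1 = q ∧ (z 1).1 = p ∧
      (z 0).2 ≠ 0 ∧ (z 1).2 ≠ 0 := by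
  obtain ⟨Γ, hΓ, h0, h1⟩ := h
  obtain ⟨z, hz, hzΓ, hz0⟩ := hΓ.exists_isNullHamiltonPath
  refine ⟨_, isNullHamiltonPath_reverse hz, ?_, ?_, ?_, ?_⟩
  · simp [reverseMomentum, hzΓ, h1]
  · simp [reverseMomentum, hzΓ, h0]
  · simpa [reverseMomentum] using hz0 1 ⟨zero_le_one, le_rfl⟩
  · simpa [reverseMomentum] using hz0 0 ⟨le_rfl, zero_le_one⟩

/-- The light rays emitted at an event. -/
theorem LightConnected.exists_path_from_emission {p q : Event} (h : M.LightConnected p q) :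
    ∃ z, IsNullHamiltonPath M.hamiltonian M.phaseSpace z ∧ (z 0).1 = p ∧ (z 1).1 = q ∧
      (z 0).2 ≠ 0 ∧ (z 1).2 ≠ 0 := by
  obtain ⟨Γ, hΓ, h0, h1⟩ := h
  obtain ⟨z, hz, hzΓ, hz0⟩ := hΓ.exists_isNullHamiltonPath
  exact ⟨z, hz, (hzΓ 0).trans h0, (hzΓ 1).trans h1, hz0 0 ⟨le_rfl, zero_le_one⟩,
    hz0 1 ⟨zero_le_one, le_rfl⟩⟩

end OpticalSpacetime

theorem theorem1 (M : OpticalSpacetime) :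
    (∀ (D : Set (Position × ℝ × Position)) (Tr : Position → ℝ → Position → ℝ),
      M.IsReceptionTimeTransfer D Tr →
      ∀ (xA : Position) (xB : Event),
        (∀ᶠ x in 𝓝 xA, (x, xB 0 / M.c, xB.position) ∈ D) →
        ContDiffAt ℝ 1 (fun x => M.receptionRange Tr x xB) xA →
        M.gBar (mkEvent (xB 0 - M.receptionRange Tr xA xB) xA) 0 0
          + 2 * ∑ i : Fin 3, M.gBar (mkEvent (xB 0 - M.receptionRange Tr xA xB) xA) 0 i.succ
              * partialDeriv i (fun x => M.receptionRange Tr x xB) xA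
          + ∑ i : Fin 3, ∑ j : Fin 3,
              M.gBar (mkEvent (xB 0 - M.receptionRange Tr xA xB) xA) i.succ j.succ
                * partialDeriv i (fun x => M.receptionRange Tr x xB) xA
                * partialDeriv j (fun x => M.receptionRange Tr x xB) xA = 0) ∧
    (∀ (D : Set (ℝ × Position × Position)) (Te : ℝ → Position → Position → ℝ),
      M.IsEmissionTimeTransfer D Te →
      ∀ (xA : Event) (xB : Position),
        (∀ᶠ x in 𝓝 xB, (xA 0 / M.c, xA.position, x) ∈ D) →
        ContDiffAt ℝ 1 (fun x => M.emissionRange Te xA x) xB →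
        M.gBar (mkEvent (xA 0 + M.emissionRange Te xA xB) xB) 0 0
          - 2 * ∑ i : Fin 3, M.gBar (mkEvent (xA 0 + M.emissionRange Te xA xB) xB) 0 i.succ
              * partialDeriv i (fun x => M.emissionRange Te xA x) xB
          + ∑ i : Fin 3, ∑ j : Fin 3,
              M.gBar (mkEvent (xA 0 + M.emissionRange Te xA xB) xB) i.succ j.succ
                * partialDeriv i (fun x => M.emissionRange Te xA x) xB
                * partialDeriv j (fun x => M.emissionRange Te xA x) xB = 0) := by
  have hc := M.c_pos.ne'
  constructor
  · intro D Tr hT xA xB hD hR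
    set R : Position → ℝ := fun x => M.receptionRange Tr x xB
    have hpath : ∀ᶠ x in 𝓝 xA, M.LightConnected (mkEvent (xB 0 - R x) x) xB := by
      filter_upwards [hD] with x hx
      have h := (hT _ _ _ hx (xB 0 / M.c - Tr x (xB 0 / M.c) xB.position)).2 (sub_sub_cancel _ _)
      rwa [mul_sub, mul_div_cancel₀ _ hc, OpticalSpacetime.mkEvent_position] at h
    have h0 := OpticalSpacetime.hamiltonian_graphConormal_eq_zero (u := fun x => xB 0 - R x)
      (contDiffAt_const.sub hR) (hpath.mono fun x hx => hx.exists_path_from_reception)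
    have hreg : mkEvent (xB 0 - R xA) xA ∈ M.region := by
      obtain ⟨z, hz, -, h1, -⟩ := hpath.self_of_nhds.exists_path_from_reception
      exact h1 ▸ (hz 1 ⟨zero_le_one, le_rfl⟩).1.1
    -- For `u = x_B⁰ - R` the conormal is `(1, ∂R)`; in the emission case it is `(1, -∂R)`, whence
    -- the opposite sign of the mixed term.
    have hn : graphConormal (fun x => xB 0 - R x) xA = Fin.cons 1 fun i => partialDeriv i R xA := by
      simp [graphConormal, partialDeriv, fderiv_const_sub]
    rw [hn] at h0
    rw [← OpticalSpacetime.two_mul_hamiltonian_cons _ hreg, h0, mul_zero]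
  · intro D Te hT xA xB hD hR
    set R : Position → ℝ := fun x => M.emissionRange Te xA x
    have hpath : ∀ᶠ x in 𝓝 xB, M.LightConnected xA (mkEvent (xA 0 + R x) x) := by
      filter_upwards [hD] with x hx
      have h := (hT _ _ _ hx (xA 0 / M.c + Te (xA 0 / M.c) xA.position x)).2 (add_sub_cancel_left _ _)
      rwa [mul_add, mul_div_cancel₀ _ hc, OpticalSpacetime.mkEvent_position] at h
    have h0 := OpticalSpacetime.hamiltonian_graphConormal_eq_zero (u := fun x => xA 0 + R x)
      (contDiffAt_const.add hR) (hpath.mono fun x hx => hx.exists_path_from_emission)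
    have hreg : mkEvent (xA 0 + R xB) xB ∈ M.region := by
      obtain ⟨z, hz, -, h1, -⟩ := hpath.self_of_nhds.exists_path_from_emission
      exact h1 ▸ (hz 1 ⟨zero_le_one, le_rfl⟩).1.1
    have hn : graphConormal (fun x => xA 0 + R x) xB
        = Fin.cons 1 fun i => -partialDeriv i R xB := by
      simp [graphConormal, partialDeriv, fderiv_const_add]
    rw [hn] at h0
    have h2 := OpticalSpacetime.two_mul_hamiltonian_cons _ hreg fun i => -partialDeriv i R xB
    rw [h0, mul_zero] at h2
    rw [h2]
    simp only [mul_neg, neg_mul, neg_neg, Finset.sum_neg_distrib]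
    ring
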